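/- Let $G$ be a connected (finite-dimensional, real, smooth) Lie group with identity $e$ and Lie algebra $\mathfrak g=T_eG$, equipped with a left-invariant Riemannian metric. Let $d$ be its Riemannian distance, $\nabla$ its Levi-Civita connection, $D_t$ the covariant derivative along curves, and $R(X,Y)Z=\nabla_X\nabla_YZ-\nabla_Y\nabla_XZ-\nabla_{[X,Y]}Z$ its curvature. For $\xi,\eta\in\mathfrak g$ put $\nabla^{\mathfrak g}_\xi\eta:=(\nabla_{\phi(\xi)}\phi(\eta))(e)$, where $\phi(\xi)$ is the left-invariant vector field with $\phi(\xi)(e)=\xi$. For $g,h\in G$ and a tangent vector $v$, write $gv$ and $vh$ for the images of $v$ under the differentials of left translation by $g$ and of right translation by $h$. Let $\mathcal E\subseteq\{1,\dots,s\}^2$ be the symmetric edge set of an undirected graph and $\mathcal N_j=\{k:(j,k)\in\mathcal E\}$. For $(j,k)\in\mathcal E$ let $V_{jk}:G\times G\to\mathbb R$ be a smooth function of the form $V_{jk}(p,q)=f_{jk}(d^2(p,q))$ with some $f_{jk}:\mathbb R\to\mathbb R$ (for instance one function $f_{jk}=f$ for all edges). Let $\operatorname{grad}_1V_{jk}(p,q)\in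 T_pG$ be the gradient at $p$ of $V_{jk}(\cdot,q)$. Let $a<b$ and let $g_1,\dots,g_s:[a,b]\to G$ be smooth curves. Put $\xi_j^{(0)}:=g_j^{-1}\dot g_j:[a,b]\to\mathfrak g$ and $h_{jk}:=g_j^{-1}g_k:[a,b]\to G$. Then the collision-avoidance Euler–Lagrange equations $$D_t^3\dot g_j+R(D_t\dot g_j,\dot g_j)\dot g_j=-\sum_{r\in\mathcal N_j}\operatorname{grad}_1V_{jr}(g_j,g_r)\qquad(j=1,\dots,s)$$ hold on $[a,b]$ if and only if there are smooth curves $\xi_j^{(1)},\xi_j^{(2)}:[a,b]\to\mathfrak g$ $(j=1,\dots,s)$ such that on $[a,b]$, for all $j$ and all $k\in\mathcal N_j$, $$\dot h_{jk}=-\xi_j^{(0)}h_{jk}+h_{jk}\xi_k^{(0)},$$ $$\dot\xi_j^{(i)}=\xi_j^{(i+1)}-\nabla^{\mathfrak g}_{\xi_j^{(0)}}\xi_j^{(i)}\qquad(i=0,1),$$ $$\dot\xi_j^{(2)}+\nabla^{\mathfrak g}_{\xi_j^{(0)}}\xi_j^{(2)}+R\big(\xi_j^{(1)},\xi_j^{(0)}\big)\xi_j^{(0)}=-\sum_{r\in\mathcal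 N_j}\operatorname{grad}_1V_{jr}(e,h_{jr}).$$ -/

import Mathlib

open Bundle Manifold VectorField
open scoped ContDiff

noncomputable section
namespace CollisionAvoidance
section LeviCivita

variable {E : Type*} [NormedAddCommGroup E] [NormedSpace ℝ E] [FiniteDimensional ℝ E]
  {H : Type*} [TopologicalSpace H] (I : ModelWithCorners ℝ E H)
  {M : Type*} [TopologicalSpace M] [ChartedSpace H M]
  [RiemannianBundle (fun x : M ↦ TangentSpace I x)]

/-- Half of the right-hand side of the Koszul formula: this is `⟨∇_X Y, Z⟩` at `x` for the
Levi-Civita connection `∇`. -/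
def koszul (Y X Z : Π x : M, TangentSpace I x) (x : M) : ℝ :=
  (1 / 2 : ℝ) *
    (mvfderiv I (fun y ↦ inner ℝ (Y y) (Z y)) x (X x)
      + mvfderiv I (fun y ↦ inner ℝ (Z y) (X y)) x (Y x)
      - mvfderiv I (fun y ↦ inner ℝ (X y) (Y y)) x (Z x)
      + inner ℝ (mlieBracket I X Y x) (Z x)
      - inner ℝ (mlieBracket I X Z x) (Y x)
      - inner ℝ (mlieBracket I Y Z x) (X x))

variable [IsManifold I ∞ M]
  [IsContMDiffRiemannianBundle I ∞ E (fun x : M ↦ TangentSpace I x)]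

instance (x : M) : FiniteDimensional ℝ (TangentSpace I x) := inferInstanceAs (FiniteDimensional ℝ E)
instance (x : M) : CompleteSpace (TangentSpace I x) := FiniteDimensional.complete ℝ _

variable {I}

set_option linter.unusedSectionVars false in
lemma mdifferentiableAt_inner {x : M} {X Y : Π x : M, TangentSpace I x}
    (hX : MDiffAt (T% X) x) (hY : MDiffAt (T% Y) x) :
    MDiffAt (fun y ↦ (inner ℝ (X y) (Y y) : ℝ)) x :=
  MDifferentiableAt.inner_bundle (IB := I) (F := E) (E := fun x : M ↦ TangentSpace I x)
    (b := id) hX hY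

lemma koszul_tensorial_left {x : M} {Y Z : Π x : M, TangentSpace I x}
    (hY : MDiffAt (T% Y) x) (hZ : MDiffAt (T% Z) x) :
    TensorialAt I E (fun X ↦ koszul I Y X Z x) x where
  smul {f X} hf hX := by
    have : CompleteSpace E := FiniteDimensional.complete ℝ E
    simp only [koszul, Pi.smul_apply', real_inner_smul_left, real_inner_smul_right]
    rw [mvfderiv_fun_mul hf (mdifferentiableAt_inner hZ hX),
      mvfderiv_fun_mul hf (mdifferentiableAt_inner hX hY),
      mlieBracket_smul_left hf hX, mlieBracket_smul_left hf hX]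
    simp [inner_add_left, real_inner_smul_right, real_inner_comm]
    ring
  add {X X'} hX hX' := by
    have : CompleteSpace E := FiniteDimensional.complete ℝ E
    simp only [koszul, Pi.add_apply, inner_add_left, inner_add_right]
    rw [mvfderiv_fun_add (mdifferentiableAt_inner hZ hX) (mdifferentiableAt_inner hZ hX'),
      mvfderiv_fun_add (mdifferentiableAt_inner hX hY) (mdifferentiableAt_inner hX' hY),
      mlieBracket_add_left hX hX', mlieBracket_add_left hX hX']
    simp [inner_add_left]
    ring

lemma koszul_tensorial_right {x : M} {Y X : Π x : M, TangentSpace I x}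
    (hY : MDiffAt (T% Y) x) (hX : MDiffAt (T% X) x) :
    TensorialAt I E (fun Z ↦ koszul I Y X Z x) x where
  smul {f Z} hf hZ := by
    have : CompleteSpace E := FiniteDimensional.complete ℝ E
    simp only [koszul, Pi.smul_apply', real_inner_smul_left, real_inner_smul_right]
    rw [mvfderiv_fun_mul hf (mdifferentiableAt_inner hY hZ),
      mvfderiv_fun_mul hf (mdifferentiableAt_inner hZ hX),
      mlieBracket_smul_right hf hZ, mlieBracket_smul_right hf hZ]
    simp [inner_add_left, real_inner_smul_right, real_inner_comm]
    ring
  add {Z Z'} hZ hZ' := by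
    have : CompleteSpace E := FiniteDimensional.complete ℝ E
    simp only [koszul, Pi.add_apply, inner_add_left, inner_add_right]
    rw [mvfderiv_fun_add (mdifferentiableAt_inner hY hZ) (mdifferentiableAt_inner hY hZ'),
      mvfderiv_fun_add (mdifferentiableAt_inner hZ hX) (mdifferentiableAt_inner hZ' hX),
      mlieBracket_add_right hZ hZ', mlieBracket_add_right hZ hZ']
    simp [inner_add_left]
    ring

variable (I)

open Classical in
/-- The underlying function of the Levi-Civita connection: `leviCivitaFun I Y x v` is `∇_v Y`,
determined by the Koszul formula if `Y` is differentiable at `x`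
(and set to zero at all other points, where it has no meaning). -/
def leviCivitaFun (Y : Π x : M, TangentSpace I x) (x : M) :
    TangentSpace I x →L[ℝ] TangentSpace I x :=
  if hY : MDiffAt (T% Y) x then
    ((InnerProductSpace.toDual ℝ
        (TangentSpace I x)).symm.toContinuousLinearEquiv.toContinuousLinearMap).comp
      (TensorialAt.mkHom₂ (I := I) (F := E) (F' := E) (koszul I Y · · x) x
        (fun _ hZ ↦ koszul_tensorial_left hY hZ) (fun _ hX ↦ koszul_tensorial_right hY hX))
  else 0

variable {I}

lemma inner_leviCivitaFun {x : M} {X Y Z : Π x : M, TangentSpace I x}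
    (hX : MDiffAt (T% X) x) (hY : MDiffAt (T% Y) x) (hZ : MDiffAt (T% Z) x) :
    inner ℝ (leviCivitaFun I Y x (X x)) (Z x) = koszul I Y X Z x := by
  rw [leviCivitaFun, dif_pos hY]
  simp
  exact TensorialAt.mkHom₂_apply _ _ hX hZ


set_option linter.unusedSectionVars false in
lemma leviCivitaFun_ext {x : M} {A B : TangentSpace I x →L[ℝ] TangentSpace I x}
    (h : ∀ X Z : Π y : M, TangentSpace I y, MDiffAt (T% X) x → MDiffAt (T% Z) x →
      (inner ℝ (A (X x)) (Z x) : ℝ) = inner ℝ (B (X x)) (Z x)) : A = B := by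
  ext v
  refine ext_inner_right ℝ fun w ↦ ?_
  simpa using h (FiberBundle.extend E v) (FiberBundle.extend E w)
    (FiberBundle.mdifferentiableAt_extend I E v) (FiberBundle.mdifferentiableAt_extend I E w)

variable (I M) in
/-- The Levi-Civita connection of a Riemannian manifold. -/
def leviCivita : CovariantDerivative I E (fun x : M ↦ TangentSpace I x) where
  toFun := leviCivitaFun I
  isCovariantDerivativeOnUniv :=
    { add := by
        intro Y Y' x hY hY' _
        have : CompleteSpace E := FiniteDimensional.complete ℝ E
        refine leviCivitaFun_ext fun X Z hX hZ ↦ ?_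
        rw [add_apply, inner_add_left,
          inner_leviCivitaFun hX (mdifferentiableAt_add_section hY hY') hZ,
          inner_leviCivitaFun hX hY hZ, inner_leviCivitaFun hX hY' hZ]
        simp only [koszul, Pi.add_apply, inner_add_left, inner_add_right]
        rw [mvfderiv_fun_add (mdifferentiableAt_inner hY hZ) (mdifferentiableAt_inner hY' hZ),
          mvfderiv_fun_add (mdifferentiableAt_inner hX hY) (mdifferentiableAt_inner hX hY'),
          mlieBracket_add_right hY hY', mlieBracket_add_left hY hY']
        simp [inner_add_left]
        ring
      leibniz := by
        intro Y f x hY hf _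
        have : CompleteSpace E := FiniteDimensional.complete ℝ E
        refine leviCivitaFun_ext fun X Z hX hZ ↦ ?_
        rw [add_apply, inner_add_left, smul_apply,
          real_inner_smul_left,
          inner_leviCivitaFun hX (hf.smul_section hY) hZ, inner_leviCivitaFun hX hY hZ]
        simp only [koszul, Pi.smul_apply', real_inner_smul_left, real_inner_smul_right]
        rw [mvfderiv_fun_mul hf (mdifferentiableAt_inner hY hZ),
          mvfderiv_fun_mul hf (mdifferentiableAt_inner hX hY),
          mlieBracket_smul_right hf hY, mlieBracket_smul_left hf hY]
        simp [inner_add_left, real_inner_smul_right, real_inner_comm]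
        ring }

lemma inner_leviCivita {x : M} {X Y Z : Π x : M, TangentSpace I x}
    (hX : MDiffAt (T% X) x) (hY : MDiffAt (T% Y) x) (hZ : MDiffAt (T% Z) x) :
    inner ℝ (leviCivita I M Y x (X x)) (Z x) = koszul I Y X Z x :=
  inner_leviCivitaFun hX hY hZ

/-- The Levi-Civita connection is torsion-free. -/
theorem leviCivita_torsion [CompleteSpace E] : (leviCivita I M).torsion = 0 := by
  rw [CovariantDerivative.torsion_eq_zero_iff]
  intro X Y x hX hY
  refine ext_inner_right ℝ fun w ↦ ?_
  have hZ := FiberBundle.mdifferentiableAt_extend I E w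
  have h1 := inner_leviCivita hX hY hZ
  have h2 := inner_leviCivita hY hX hZ
  rw [FiberBundle.extend_apply_self] at h1 h2
  rw [inner_sub_left, h1, h2]
  simp only [koszul]
  rw [mlieBracket_swap_apply (V := Y) (W := X)]
  simp [real_inner_comm]
  ring

/-- The Levi-Civita connection is compatible with the metric. -/
theorem leviCivita_metric {x : M} {X Y Z : Π x : M, TangentSpace I x}
    (hX : MDiffAt (T% X) x) (hY : MDiffAt (T% Y) x) (hZ : MDiffAt (T% Z) x) :
    mvfderiv I (fun y ↦ (inner ℝ (Y y) (Z y) : ℝ)) x (X x) =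
      inner ℝ (leviCivita I M Y x (X x)) (Z x) + inner ℝ (Y x) (leviCivita I M Z x (X x)) := by
  have : CompleteSpace E := FiniteDimensional.complete ℝ E
  rw [inner_leviCivita hX hY hZ, real_inner_comm _ (Y x), inner_leviCivita hX hZ hY]
  simp only [koszul]
  rw [mlieBracket_swap_apply (V := Z) (W := Y)]
  simp [real_inner_comm]
  ring

end LeviCivita

section Riemannian

variable {E : Type*} [NormedAddCommGroup E] [NormedSpace ℝ E] [FiniteDimensional ℝ E]
  {H : Type*} [TopologicalSpace H] (I : ModelWithCorners ℝ E H)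
  {M : Type*} [TopologicalSpace M] [ChartedSpace H M]
  [RiemannianBundle (fun x : M ↦ TangentSpace I x)]

/-- The Riemannian distance: the infimum of the lengths of the curves joining two points. -/
def riemannianDist (x y : M) : ℝ := (riemannianEDist I x y).toReal

/-- The gradient of `U` at `x`: the vector representing `dU` at `x` through the metric. -/
def gradient (U : M → ℝ) (x : M) : TangentSpace I x :=
  (InnerProductSpace.toDual ℝ (TangentSpace I x)).symm (mvfderiv I U x)

/-- The gradient of `V` with respect to its first argument, at `(x, y)`. -/
def gradient₁ (V : M → M → ℝ) (x y : M) : TangentSpace I x :=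
  gradient I (fun z ↦ V z y) x

/-- The velocity of a curve `q` at the time `t`, the time being restricted to `J`. -/
def velocity (q : ℝ → M) (J : Set ℝ) (t : ℝ) : TangentSpace I (q t) :=
  mfderivWithin 𝓘(ℝ, ℝ) I q J t (1 : ℝ)

variable [IsManifold I ∞ M]
  [IsContMDiffRiemannianBundle I ∞ E (fun x : M ↦ TangentSpace I x)]

/-- The curvature endomorphism `R(X, Y)Z = ∇_X ∇_Y Z - ∇_Y ∇_X Z - ∇_[X, Y] Z` of the Levi-Civita
connection, on vector fields. -/
def curvatureField (X Y Z : Π x : M, TangentSpace I x) (x : M) : TangentSpace I x :=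
  leviCivita I M (fun y ↦ leviCivita I M Z y (Y y)) x (X x)
    - leviCivita I M (fun y ↦ leviCivita I M Z y (X y)) x (Y x)
    - leviCivita I M Z x (mlieBracket I X Y x)

/-- The curvature endomorphism `R(u, v)w` on tangent vectors at `x`, computed with extensions of
`u`, `v`, `w` to vector fields that are smooth near `x` (the value does not depend on them, as the
curvature is a tensor). -/
def curvature (x : M) (u v w : TangentSpace I x) : TangentSpace I x :=
  curvatureField I (FiberBundle.extend E u) (FiberBundle.extend E v) (FiberBundle.extend E w) x

/-- The covariant derivative `D_t W` of a vector field `W` along a curve `q : J → M`.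
Let `e` be the trivialization of the tangent bundle at `q t` and `E_i` the corresponding local
frame. If `W = ∑ W^i E_i` along `q`, then `D_t W = ∑ (dW^i/dt) E_i + ∑ W^i ∇_{dq/dt} E_i`.
The second sum is `∇_{dq/dt}` of the vector field `FiberBundle.extend E (W t)`, which has the
constant coefficients `W^i(t)` in this frame. -/
def covDerivAlong (q : ℝ → M) (J : Set ℝ) (W : Π t : ℝ, TangentSpace I (q t)) (t : ℝ) :
    TangentSpace I (q t) :=
  (trivializationAt E (TangentSpace I : M → Type _) (q t)).symm (q t)
      (derivWithin
        (fun r ↦ ((trivializationAt E (TangentSpace I : M → Type _) (q t)) ⟨q r, W r⟩).2) J t)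
    + leviCivita I M (FiberBundle.extend E (W t)) (q t) (velocity I q J t)

end Riemannian

section LieGroup

variable {E : Type*} [NormedAddCommGroup E] [NormedSpace ℝ E] [FiniteDimensional ℝ E]
  {H : Type*} [TopologicalSpace H] (I : ModelWithCorners ℝ E H)
  {G : Type*} [TopologicalSpace G] [ChartedSpace H G] [Group G]

/-- The infinitesimal left translation of a tangent vector `v` at `h` to `k * h`. -/
def leftTranslate (k : G) {h : G} (v : TangentSpace I h) : TangentSpace I (k * h) :=
  mfderiv I I (fun x : G ↦ k * x) h v

/-- `ξ h`, the infinitesimal right translation of `ξ` in the Lie algebra to `h`. -/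
def rightMul (ξ : TangentSpace I (1 : G)) (h : G) : TangentSpace I h :=
  mfderiv I I (fun x : G ↦ x * h) 1 ξ

/-- The body velocity `g⁻¹ (dg/dt)` of a curve `g` in a Lie group. -/
def bodyVelocity (g : ℝ → G) (J : Set ℝ) (t : ℝ) : TangentSpace I (1 : G) :=
  mfderiv I I (fun x : G ↦ (g t)⁻¹ * x) (g t) (velocity I g J t)

variable [RiemannianBundle (fun x : G ↦ TangentSpace I x)]

variable (G) in
/-- The Riemannian metric is left-invariant: all left translations are isometries. -/
def IsLeftInvariantMetric : Prop :=
  ∀ (k h : G) (v w : TangentSpace I h),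
    (inner ℝ (leftTranslate I k v) (leftTranslate I k w) : ℝ) = inner ℝ v w

variable [LieGroup I ∞ G]
  [IsContMDiffRiemannianBundle I ∞ E (fun x : G ↦ TangentSpace I x)]

/-- The Riemannian `𝔤`-connection: `∇^𝔤_ξ η = (∇_{φ(ξ)} φ(η)) (e)`, where `φ(ξ)` is the
left-invariant vector field with the value `ξ` at the identity `e`. -/
def algConnection (ξ η : TangentSpace I (1 : G)) : TangentSpace I (1 : G) :=
  leviCivita I G (mulInvariantVectorField η) 1 (mulInvariantVectorField ξ 1)

open Classical in
/-- The set of neighbors of the agent `j` in the graph with the edge set `Edges`. -/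
def neighbors {s : ℕ} (Edges : Set (Fin s × Fin s)) (j : Fin s) : Finset (Fin s) :=
  {k | (j, k) ∈ Edges}

variable {s : ℕ}

/-- The collision avoidance Euler-Lagrange equations
`D_t^3 ġ_j + R(D_t ġ_j, ġ_j) ġ_j = - ∑_{r ∈ N_j} grad₁ V_{jr}(g_j, g_r)` on `[a, b]`. -/
def SolvesEulerLagrange (Edges : Set (Fin s × Fin s)) (V : Fin s → Fin s → G → G → ℝ)
    (a b : ℝ) (g : Fin s → ℝ → G) : Prop :=
  ∀ j, ∀ t ∈ Set.Icc a b,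
    covDerivAlong I (g j) (Set.Icc a b)
        (covDerivAlong I (g j) (Set.Icc a b)
          (covDerivAlong I (g j) (Set.Icc a b) (velocity I (g j) (Set.Icc a b)))) t
      + curvature I (g j t)
          (covDerivAlong I (g j) (Set.Icc a b) (velocity I (g j) (Set.Icc a b)) t)
          (velocity I (g j) (Set.Icc a b) t) (velocity I (g j) (Set.Icc a b) t)
    = - ∑ r ∈ neighbors Edges j, gradient₁ I (V j r) (g j t) (g r t)

/-- The reduced equations on `[a, b]`, for curves `h j k` in `G` and curves `ξ i j` in the Lie
algebra (`i = 0, 1, 2` is the order and `j` is the agent). -/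
structure SolvesReduced (Edges : Set (Fin s × Fin s)) (V : Fin s → Fin s → G → G → ℝ)
    (a b : ℝ) (h : Fin s → Fin s → ℝ → G) (ξ : Fin 3 → Fin s → ℝ → TangentSpace I (1 : G)) :
    Prop where
  /-- `ḣ_{jk} = - ξ_j^{(0)} h_{jk} + h_{jk} ξ_k^{(0)}` -/
  reconstruction : ∀ j, ∀ k ∈ neighbors Edges j, ∀ t ∈ Set.Icc a b,
    velocity I (h j k) (Set.Icc a b) t
      = - rightMul I (ξ 0 j t) (h j k t) + mulInvariantVectorField (ξ 0 k t) (h j k t)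
  /-- `ξ̇_j^{(i)} = ξ_j^{(i+1)} - ∇^𝔤_{ξ_j^{(0)}} ξ_j^{(i)}` for `i = 0, 1` -/
  recursion : ∀ i : Fin 2, ∀ j, ∀ t ∈ Set.Icc a b,
    derivWithin (ξ i.castSucc j) (Set.Icc a b) t
      = ξ i.succ j t - algConnection I (ξ 0 j t) (ξ i.castSucc j t)
  /-- `ξ̇_j^{(2)} + ∇^𝔤_{ξ_j^{(0)}} ξ_j^{(2)} + R(ξ_j^{(1)}, ξ_j^{(0)}) ξ_j^{(0)}
  = - ∑_{r ∈ N_j} grad₁ V_{jr}(e, h_{jr})` -/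
  dynamics : ∀ j, ∀ t ∈ Set.Icc a b,
    derivWithin (ξ 2 j) (Set.Icc a b) t + algConnection I (ξ 0 j t) (ξ 2 j t)
        + curvature I (1 : G) (ξ 1 j t) (ξ 0 j t) (ξ 0 j t)
      = - ∑ r ∈ neighbors Edges j, gradient₁ I (V j r) 1 (h j r t)

end LieGroup

end CollisionAvoidance
end

noncomputable section
namespace CollisionAvoidance

section Translation

variable {E : Type*} [NormedAddCommGroup E] [NormedSpace ℝ E]
  {H : Type*} [TopologicalSpace H] (I : ModelWithCorners ℝ E H)
  {G : Type*} [TopologicalSpace G] [ChartedSpace H G] [Group G]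

/-- The differential at the identity of the left translation by `x`. -/
def ofBody (x : G) : TangentSpace I (1 : G) →L[ℝ] TangentSpace I x :=
  mfderiv I I (fun y : G ↦ x * y) 1

/-- The differential at `x` of the left translation by `x⁻¹`. -/
def toBody (x : G) : TangentSpace I x →L[ℝ] TangentSpace I (1 : G) :=
  mfderiv I I (fun y : G ↦ x⁻¹ * y) x

lemma mulInvariantVectorField_eq_ofBody (ξ : TangentSpace I (1 : G)) (x : G) :
    mulInvariantVectorField ξ x = ofBody I x ξ := rfl

variable [LieGroup I ∞ G]

variable {I} in
lemma mdifferentiableAt_mul_left (k x : G) : MDiffAt (fun y : G ↦ k * y) x :=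
  (contMDiff_mul_left (I := I) (n := ∞)).contMDiffAt.mdifferentiableAt (by simp)

lemma mfderiv_mul_left_comp (k l x : G) (v : TangentSpace I x) :
    (mfderiv I I (fun y : G ↦ k * y) (l * x)) ((mfderiv I I (fun y : G ↦ l * y) x) v)
      = (mfderiv I I (fun y : G ↦ k * l * y) x) v := by
  have : (fun y : G ↦ k * l * y) = (fun y : G ↦ k * y) ∘ (fun y : G ↦ l * y) := by
    ext y; simp [mul_assoc]
  rw [this, mfderiv_comp (I' := I) _ (mdifferentiableAt_mul_left _ _)
    (mdifferentiableAt_mul_left _ _)]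
  rfl

omit [LieGroup I ∞ G] in
lemma mfderiv_mul_left_of_eq_one {k : G} (hk : k = 1) (x : G) (v : TangentSpace I x) :
    (mfderiv I I (fun y : G ↦ k * y) x) v = v := by
  subst hk
  have : (fun y : G ↦ 1 * y) = id := by ext; simp
  rw [this, mfderiv_id]
  rfl

lemma ofBody_toBody (x : G) (v : TangentSpace I x) : ofBody I x (toBody I x v) = v := by
  have h := mfderiv_mul_left_comp I x x⁻¹ x v
  rw [mfderiv_mul_left_of_eq_one I (mul_inv_cancel x)] at h
  have key : ∀ z : G, z = x⁻¹ * x →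
      (mfderiv I I (fun y : G ↦ x * y) z) (toBody I x v) = v := by
    rintro z rfl
    exact h
  exact key 1 (inv_mul_cancel x).symm

lemma toBody_ofBody (x : G) (ξ : TangentSpace I (1 : G)) : toBody I x (ofBody I x ξ) = ξ := by
  have h := mfderiv_mul_left_comp I x⁻¹ x 1 ξ
  rw [mfderiv_mul_left_of_eq_one I (inv_mul_cancel x)] at h
  have key : ∀ z : G, z = x * 1 →
      (mfderiv I I (fun y : G ↦ x⁻¹ * y) z) (ofBody I x ξ) = ξ := by
    rintro z rfl
    exact h
  exact key x (mul_one x).symm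

omit [LieGroup I ∞ G] in
lemma ofBody_one (ξ : TangentSpace I (1 : G)) : ofBody I 1 ξ = ξ :=
  mfderiv_mul_left_of_eq_one I rfl 1 ξ

lemma ofBody_mul (k x : G) (ξ : TangentSpace I (1 : G)) :
    ofBody I (k * x) ξ = mfderiv I I (fun y : G ↦ k * y) x (ofBody I x ξ) := by
  have h := mfderiv_mul_left_comp I k x 1 ξ
  have key : ∀ z : G, z = x * 1 →
      (mfderiv I I (fun y : G ↦ k * y) z) (ofBody I x ξ) = ofBody I (k * x) ξ := by
    rintro z rfl
    exact h
  exact (key x (mul_one x).symm).symm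

variable {I}

/-- Left-invariant vector fields are smooth. -/
lemma contMDiff_mulInvariantVectorField_infty (ξ : TangentSpace I (1 : G)) :
    ContMDiff I I.tangent ∞ (T% (mulInvariantVectorField ξ : Π x : G, TangentSpace I x)) := by
  let fg : G → TangentBundle I G := fun g ↦ TotalSpace.mk' E g 0
  have sfg : CMDiff ∞ fg := contMDiff_zeroSection _ _
  let fv : G → TangentBundle I G := fun _ ↦ TotalSpace.mk' E 1 ξ
  have sfv : CMDiff ∞ fv := contMDiff_const
  let F₁ : G → (TangentBundle I G × TangentBundle I G) := fun g ↦ (fg g, fv g)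
  have S₁ : CMDiff ∞ F₁ := sfg.prodMk sfv
  let F₂ : (TangentBundle I G × TangentBundle I G) → TangentBundle (I.prod I) (G × G) :=
    (equivTangentBundleProd I G I G).symm
  have S₂ : CMDiff ∞ F₂ := contMDiff_equivTangentBundleProd_symm
  let F₃ : TangentBundle (I.prod I) (G × G) → TangentBundle I G :=
    tangentMap% (fun (p : G × G) ↦ p.1 * p.2)
  have S₃ : CMDiff ∞ F₃ :=
    ContMDiff.contMDiff_tangentMap (contMDiff_mul I ∞) (m := ∞) le_rfl
  let S := (S₃.comp S₂).comp S₁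
  convert! S with g
  · simp [F₁, F₂, F₃, fg, fv]
  · simp only [Function.comp_apply, tangentMap, F₃, F₂, F₁, fg, fv]
    rw [mfderiv_prod_eq_add_apply ((contMDiff_mul I ∞).mdifferentiableAt (by simp))]
    have key : (mfderiv I I (fun y : G ↦ g * y) 1 ξ : E) =
        (mfderiv I I (fun y : G ↦ y * 1) g (0 : TangentSpace I g) : E)
          + (mfderiv I I (fun y : G ↦ g * y) 1 ξ : E) := by
      rw [map_zero]
      exact (zero_add _).symm
    exact key

lemma mdifferentiableAt_mulInvariant (ξ : TangentSpace I (1 : G)) (x : G) :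
    MDiffAt (T% (mulInvariantVectorField ξ : Π x : G, TangentSpace I x)) x :=
  (contMDiff_mulInvariantVectorField_infty ξ).contMDiffAt.mdifferentiableAt (by simp)

lemma mlieBracket_mulInvariant [CompleteSpace E] (ξ η : TangentSpace I (1 : G)) (x : G) :
    mlieBracket I (mulInvariantVectorField ξ) (mulInvariantVectorField η) x
      = ofBody I x (mlieBracket I (mulInvariantVectorField ξ) (mulInvariantVectorField η) 1) := by
  have : LieGroup I (minSmoothness ℝ 3) G :=
    LieGroup.of_le (n := ∞) (by simp only [minSmoothness_of_isRCLikeNormedField]; norm_cast)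
  rw [← mulInvariantVectorField_eq_ofBody, mulInvariantVector_mlieBracket]

end Translation

section LeviCivita

variable {E : Type*} [NormedAddCommGroup E] [NormedSpace ℝ E]
  {H : Type*} [TopologicalSpace H] {I : ModelWithCorners ℝ E H}
  {G : Type*} [TopologicalSpace G] [ChartedSpace H G] [Group G]
  [RiemannianBundle (fun x : G ↦ TangentSpace I x)]

lemma IsLeftInvariantMetric.inner_ofBody (hinv : IsLeftInvariantMetric I G) (x : G)
    (ξ η : TangentSpace I (1 : G)) :
    (inner ℝ (ofBody I x ξ) (ofBody I x η) : ℝ) = inner ℝ ξ η := by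
  have key : ∀ z : G, z = x * 1 → ∀ u v : TangentSpace I z, u = leftTranslate I x ξ →
      v = leftTranslate I x η → (inner ℝ u v : ℝ) = inner ℝ ξ η := by
    rintro z rfl u v rfl rfl
    exact hinv x 1 ξ η
  exact key x (mul_one x).symm _ _ rfl rfl

variable [LieGroup I ∞ G]

lemma IsLeftInvariantMetric.inner_toBody (hinv : IsLeftInvariantMetric I G) (x : G)
    (u v : TangentSpace I x) :
    (inner ℝ (toBody I x u) (toBody I x v) : ℝ) = inner ℝ u v := by
  rw [← hinv.inner_ofBody x, ofBody_toBody, ofBody_toBody]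

variable [FiniteDimensional ℝ E]
  [IsContMDiffRiemannianBundle I ∞ E (fun x : G ↦ TangentSpace I x)]

lemma leviCivita_mulInvariant (hinv : IsLeftInvariantMetric I G) (x : G)
    (ξ η : TangentSpace I (1 : G)) :
    leviCivita I G (mulInvariantVectorField η) x (ofBody I x ξ)
      = ofBody I x (algConnection I ξ η) := by
  have : CompleteSpace E := FiniteDimensional.complete ℝ E
  have main (z : G) (ζ : TangentSpace I (1 : G)) :
      (inner ℝ (leviCivita I G (mulInvariantVectorField η) z (mulInvariantVectorField ξ z))
        (mulInvariantVectorField ζ z) : ℝ) = (1 / 2 : ℝ) *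
      (inner ℝ (mlieBracket I (mulInvariantVectorField ξ) (mulInvariantVectorField η) 1) ζ
      - inner ℝ (mlieBracket I (mulInvariantVectorField ξ) (mulInvariantVectorField ζ) 1) η
      - inner ℝ (mlieBracket I (mulInvariantVectorField η) (mulInvariantVectorField ζ) 1) ξ) := by
    rw [inner_leviCivita (mdifferentiableAt_mulInvariant _ _) (mdifferentiableAt_mulInvariant _ _)
      (mdifferentiableAt_mulInvariant _ _)]
    simp only [koszul, mlieBracket_mulInvariant _ _ z]
    simp only [mulInvariantVectorField_eq_ofBody, hinv.inner_ofBody, mvfderiv_const]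
    simp
  refine ext_inner_right ℝ fun w ↦ ?_
  rw [← ofBody_toBody I x w, hinv.inner_ofBody]
  have h := main x (toBody I x w)
  have h1 := main 1 (toBody I x w)
  rw [← mulInvariantVectorField_eq_ofBody, ← mulInvariantVectorField_eq_ofBody, h, ← h1,
    ← algConnection, mulInvariantVectorField_eq_ofBody, ofBody_one]

end LeviCivita

section BodyCoordinates

variable {E : Type*} [NormedAddCommGroup E] [NormedSpace ℝ E]
  {H : Type*} [TopologicalSpace H] {I : ModelWithCorners ℝ E H}
  {G : Type*} [TopologicalSpace G] [ChartedSpace H G] [Group G]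
  [RiemannianBundle (fun x : G ↦ TangentSpace I x)] [LieGroup I ∞ G]
  [FiniteDimensional ℝ E]
  [IsContMDiffRiemannianBundle I ∞ E (fun x : G ↦ TangentSpace I x)]
  {E' : Type*} [NormedAddCommGroup E'] [NormedSpace ℝ E']
  {H' : Type*} [TopologicalSpace H'] {J : ModelWithCorners ℝ E' H'}
  {M : Type*} [TopologicalSpace M] [ChartedSpace H' M]

omit [FiniteDimensional ℝ E] [IsContMDiffRiemannianBundle I ∞ E (fun x : G ↦ TangentSpace I x)]
  in
lemma toBody_eq_sum (hinv : IsLeftInvariantMetric I G) {ι : Type*} [Fintype ι]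
    (e : OrthonormalBasis ι ℝ (TangentSpace I (1 : G))) (x : G) (v : TangentSpace I x) :
    toBody I x v = ∑ i, (inner ℝ (mulInvariantVectorField (e i) x) v : ℝ) • e i := by
  rw [← e.sum_repr' (toBody I x v)]
  refine Finset.sum_congr rfl fun i _ ↦ ?_
  rw [mulInvariantVectorField_eq_ofBody, ← hinv.inner_toBody x, toBody_ofBody]

omit [LieGroup I ∞ G] [FiniteDimensional ℝ E]
  [IsContMDiffRiemannianBundle I ∞ E (fun x : G ↦ TangentSpace I x)] in
lemma ofBody_eq_sum {ι : Type*} [Fintype ι]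
    (e : OrthonormalBasis ι ℝ (TangentSpace I (1 : G))) (x : G) (ξ : TangentSpace I (1 : G)) :
    ofBody I x ξ = ∑ i, (inner ℝ (e i) ξ : ℝ) • mulInvariantVectorField (e i) x := by
  conv_lhs => rw [← e.sum_repr' ξ]
  simp only [map_sum, map_smul, mulInvariantVectorField_eq_ofBody]


lemma contMDiffWithinAt_toBody (hinv : IsLeftInvariantMetric I G) {n : ℕ∞} {q : M → G}
    {W : Π m : M, TangentSpace I (q m)} {s : Set M} {m : M}
    (hW : ContMDiffWithinAt J I.tangent n (fun m ↦ (W m : TangentBundle I G)) s m) :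
    ContMDiffWithinAt J 𝓘(ℝ, TangentSpace I (1 : G)) n (fun m ↦ toBody I (q m) (W m)) s m := by
  let e := stdOrthonormalBasis ℝ (TangentSpace I (1 : G))
  have hq : ContMDiffWithinAt J I n q s m := (contMDiffWithinAt_totalSpace.1 hW).1
  have : IsContMDiffRiemannianBundle I n E (fun x : G ↦ TangentSpace I x) :=
    IsContMDiffRiemannianBundle.of_le (n := ∞) (by exact_mod_cast le_top)
  simp only [toBody_eq_sum hinv e]
  refine contMDiffWithinAt_finsetSum fun i _ ↦ ?_
  have h : ContMDiffWithinAt J 𝓘(ℝ, ℝ) n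
      (fun m ↦ (inner ℝ (mulInvariantVectorField (e i) (q m)) (W m) : ℝ)) s m := by
    refine ContMDiffWithinAt.inner_bundle (IB := I) (F := E) ?_ hW
    exact ((contMDiff_mulInvariantVectorField_infty (e i)).of_le
      (by exact_mod_cast le_top)).contMDiffAt.comp_contMDiffWithinAt m hq
  exact h.smul contMDiffWithinAt_const

lemma mdifferentiableAt_toBody (hinv : IsLeftInvariantMetric I G)
    {Y : Π x : G, TangentSpace I x} {x : G} (hY : MDiffAt (T% Y) x) :
    MDifferentiableAt I 𝓘(ℝ, TangentSpace I (1 : G)) (fun y ↦ toBody I y (Y y)) x := by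
  let e := stdOrthonormalBasis ℝ (TangentSpace I (1 : G))
  simp only [toBody_eq_sum hinv e]
  have h (i) : MDifferentiableAt I 𝓘(ℝ, TangentSpace I (1 : G))
      (fun y ↦ (inner ℝ (mulInvariantVectorField (e i) y) (Y y) : ℝ) • e i) x :=
    (mdifferentiableAt_inner (mdifferentiableAt_mulInvariant (e i) _) hY).smul
      mdifferentiableAt_const
  have := MDifferentiableAt.sum (t := Finset.univ) fun i _ ↦ h i
  convert! this using 1
  ext y
  simp

section Coordinates

variable {g' : Type*} [NormedAddCommGroup g'] [InnerProductSpace ℝ g']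

lemma mdifferentiableAt_inner_const {w : M → g'} {x : M}
    (hw : MDifferentiableAt J 𝓘(ℝ, g') w x) (c : g') :
    MDifferentiableAt J 𝓘(ℝ, ℝ) (fun y ↦ (inner ℝ c (w y) : ℝ)) x :=
  (innerSL ℝ c).mdifferentiable.mdifferentiableAt.comp x hw

lemma mvfderiv_inner_const {w : M → g'} {x : M}
    (hw : MDifferentiableAt J 𝓘(ℝ, g') w x) (c : g') (v : TangentSpace J x) :
    mvfderiv J (fun y ↦ (inner ℝ c (w y) : ℝ)) x v = inner ℝ c (mvfderiv J w x v) := by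
  have h := mfderiv_comp (I' := 𝓘(ℝ, g')) x
    ((innerSL ℝ c).mdifferentiable.mdifferentiableAt (x := w x)) hw
  have h' := congr($h v)
  rw [ContinuousLinearMap.mfderiv_eq] at h'
  exact h'

end Coordinates

omit [IsContMDiffRiemannianBundle I ∞ E (fun x : G ↦ TangentSpace I x)] in
lemma mdifferentiableAt_ofBody {w : G → TangentSpace I (1 : G)} {x : G}
    (hw : MDifferentiableAt I 𝓘(ℝ, TangentSpace I (1 : G)) w x) :
    MDiffAt (T% (fun y ↦ ofBody I y (w y))) x := by
  let e := stdOrthonormalBasis ℝ (TangentSpace I (1 : G))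
  simp only [ofBody_eq_sum e]
  exact MDifferentiableAt.sum_section fun i _ ↦
    (mdifferentiableAt_inner_const hw (e i)).smul_section (mdifferentiableAt_mulInvariant _ _)

end BodyCoordinates

section Connection

variable {E : Type*} [NormedAddCommGroup E] [NormedSpace ℝ E]
  {H : Type*} [TopologicalSpace H] {I : ModelWithCorners ℝ E H}
  {M : Type*} [TopologicalSpace M] [ChartedSpace H M] [IsManifold I ∞ M]
  (cov : CovariantDerivative I E (fun x : M ↦ TangentSpace I x))

lemma _root_.CovariantDerivative.sum_smul {ι : Type*} (s : Finset ι) {f : ι → M → ℝ}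
    {σ : ι → Π x : M, TangentSpace I x} {x : M} (hf : ∀ i, MDiffAt (f i) x)
    (hσ : ∀ i, MDiffAt (T% (σ i)) x) (v : TangentSpace I x) :
    cov (fun y ↦ ∑ i ∈ s, f i y • σ i y) x v
      = ∑ i ∈ s, (f i x • cov (σ i) x v + mvfderiv I (f i) x v • σ i x) := by
  classical
  induction s using Finset.induction_on with
  | empty =>
    have := cov.zero
    simp only [Finset.sum_empty]
    change cov 0 x v = 0
    rw [this]
    rfl
  | insert a s ha ih =>
    simp only [Finset.sum_insert ha, ← ih]
    have h1 := cov.isCovariantDerivativeOnUniv.add ((hf a).smul_section (hσ a))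
      (MDifferentiableAt.sum_section (s := s) fun i _ ↦ (hf i).smul_section (hσ i))
      (Set.mem_univ x)
    have h2 := cov.isCovariantDerivativeOnUniv.leibniz (hσ a) (hf a) (Set.mem_univ x)
    have h3 := congr($h1 v)
    have h4 := congr($h2 v)
    refine h3.trans ?_
    rw [add_apply]
    congr 1

variable [FiniteDimensional ℝ E]

/-- In the trivialization at `x`, a connection is the ordinary derivative plus its value on the
extension with constant coefficients. -/
lemma _root_.CovariantDerivative.eq_symm_mvfderiv_add_extend {σ : Π x : M, TangentSpace I x}
    {x : M} (hσ : MDiffAt (T% σ) x) (v : TangentSpace I x) :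
    cov σ x v = (trivializationAt E (TangentSpace I : M → Type _) x).symm x
        (mvfderiv I
          (fun y ↦ ((trivializationAt E (TangentSpace I : M → Type _) x) ⟨y, σ y⟩).2) x v)
      + cov (FiberBundle.extend E (σ x)) x v := by
  let T := trivializationAt E (TangentSpace I : M → Type _) x
  let c : M → E := fun y ↦ (T ⟨y, σ y⟩).2
  have hx : x ∈ T.baseSet := FiberBundle.mem_baseSet_trivializationAt' x
  have hc : MDifferentiableAt I 𝓘(ℝ, E) c x := by
    have := hσ
    rw [mdifferentiableAt_totalSpace] at this
    exact this.2
  let b := Module.finBasis ℝ E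
  let l (i) : E →L[ℝ] ℝ := LinearMap.toContinuousLinearMap (b.coord i)
  have hl (i) : MDifferentiableAt I 𝓘(ℝ, ℝ) (fun y ↦ l i (c y)) x :=
    (l i).mdifferentiable.mdifferentiableAt.comp x hc
  have hdl (i) : mvfderiv I (fun y ↦ l i (c y)) x v = l i (mvfderiv I c x v) := by
    have h := mfderiv_comp (I' := 𝓘(ℝ, E)) x
      ((l i).mdifferentiable.mdifferentiableAt (x := c x)) hc
    have h' := congr($h v)
    rw [ContinuousLinearMap.mfderiv_eq] at h'
    exact h'
  let s (i) : Π y : M, TangentSpace I y := FiberBundle.extend E (T.symm x (b i))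
  have hs (i) : MDiffAt (T% (s i)) x := FiberBundle.mdifferentiableAt_extend I E _
  have hs' (i) (y : M) : s i y = T.symm y (b i) := by
    simp only [s, FiberBundle.extend]
    congr 1
    exact congrArg Prod.snd (T.apply_mk_symm hx (b i))
  have hsum {y : M} (hy : y ∈ T.baseSet) (w : E) : T.symm y w = ∑ i, l i w • s i y := by
    simp only [hs', ← T.coe_symmₗ (R := ℝ) hy]
    conv_lhs => rw [← b.sum_repr w]
    rw [map_sum]
    simp [l]
  have h1 : cov σ x = cov (fun y ↦ ∑ i, l i (c y) • s i y) x := by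
    refine cov.isCovariantDerivativeOnUniv.congr_of_eventuallyEq hσ
      (MDifferentiableAt.sum_section fun i _ ↦ (hl i).smul_section (hs i)) Filter.univ_mem ?_
    filter_upwards [T.open_baseSet.mem_nhds hx] with y hy
    rw [← hsum hy]
    exact (T.symm_apply_apply_mk hy _).symm
  have h2 : cov (FiberBundle.extend E (σ x)) x = cov (fun y ↦ ∑ i, l i (c x) • s i y) x := by
    refine cov.isCovariantDerivativeOnUniv.congr_of_eventuallyEq
      (FiberBundle.mdifferentiableAt_extend I E _)
      (MDifferentiableAt.sum_section fun i _ ↦ mdifferentiableAt_const.smul_section (hs i))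
      Filter.univ_mem ?_
    filter_upwards [T.open_baseSet.mem_nhds hx] with y hy
    rw [← hsum hy]
    rfl
  rw [h1, h2, cov.sum_smul Finset.univ hl hs, cov.sum_smul Finset.univ
    (fun i ↦ mdifferentiableAt_const) hs, hsum hx, ← Finset.sum_add_distrib]
  refine Finset.sum_congr rfl fun i _ ↦ ?_
  rw [hdl, mvfderiv_const]
  simp only [zero_apply, zero_smul, add_zero]
  exact add_comm _ _

end Connection

section CovariantDerivatives

section VectorValued

variable {E : Type*} [NormedAddCommGroup E] [NormedSpace ℝ E]
  {H : Type*} [TopologicalSpace H] {I : ModelWithCorners ℝ E H}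
  {M : Type*} [TopologicalSpace M] [ChartedSpace H M]
  {F : Type*} [NormedAddCommGroup F] [NormedSpace ℝ F]

lemma mvfderiv_congr_of_eventuallyEq {f f' : M → F} {x : M} (h : f =ᶠ[nhds x] f') :
    mvfderiv I f x = mvfderiv I f' x := by
  ext v
  exact congrArg (fun A : TangentSpace I x →L[ℝ] F ↦ A v) h.mfderiv_eq

lemma mvfderiv_fun_sum_const_smul {ι : Type*} (s : Finset ι) (a : ι → ℝ) {c : ι → M → F}
    {x : M} (hc : ∀ i, MDifferentiableAt I 𝓘(ℝ, F) (c i) x) (v : TangentSpace I x) :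
    mvfderiv I (fun y ↦ ∑ i ∈ s, a i • c i y) x v = ∑ i ∈ s, a i • mvfderiv I (c i) x v := by
  classical
  have hmd (s : Finset ι) : MDifferentiableAt I 𝓘(ℝ, F) (fun y ↦ ∑ i ∈ s, a i • c i y) x := by
    induction s using Finset.induction_on with
    | empty => simpa using mdifferentiableAt_const
    | insert i s hi ih =>
      simp only [Finset.sum_insert hi]
      exact ((hc i).const_smul (a i)).add ih
  induction s using Finset.induction_on with
  | empty => simp [mvfderiv_const]
  | insert i s hi ih =>
    simp only [Finset.sum_insert hi]
    have hci : MDifferentiableAt I 𝓘(ℝ, F) (fun y ↦ a i • c i y) x := (hc i).const_smul (a i)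
    rw [mvfderiv_fun_add hci (hmd s), add_apply, ih,
      mvfderiv_fun_smul mdifferentiableAt_const (hc i), mvfderiv_const]
    simp

end VectorValued

variable {E : Type*} [NormedAddCommGroup E] [NormedSpace ℝ E]
  {H : Type*} [TopologicalSpace H] {I : ModelWithCorners ℝ E H}
  {G : Type*} [TopologicalSpace G] [ChartedSpace H G] [Group G]
  [RiemannianBundle (fun x : G ↦ TangentSpace I x)] [LieGroup I ∞ G]
  [FiniteDimensional ℝ E]
  [IsContMDiffRiemannianBundle I ∞ E (fun x : G ↦ TangentSpace I x)]

variable (I G) in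
/-- The bilinear map `(ξ, η) ↦ ∇^𝔤_ξ η`. -/
def algConnectionL : TangentSpace I (1 : G) →L[ℝ] TangentSpace I (1 : G) →L[ℝ]
    TangentSpace I (1 : G) :=
  LinearMap.toContinuousBilinearMap <| LinearMap.mk₂ ℝ (algConnection I)
    (fun ξ ξ' η ↦ by
      simp only [algConnection, mulInvariantVectorField_eq_ofBody, map_add])
    (fun c ξ η ↦ by
      simp only [algConnection, mulInvariantVectorField_eq_ofBody, map_smul])
    (fun ξ η η' ↦ by
      have h := (leviCivita I G).isCovariantDerivativeOnUniv.add
        (mdifferentiableAt_mulInvariant η (1 : G)) (mdifferentiableAt_mulInvariant η' (1 : G))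
        (Set.mem_univ _)
      rw [algConnection, mulInvariantVectorField_add, h]
      rfl)
    (fun c ξ η ↦ by
      have h := (leviCivita I G).isCovariantDerivativeOnUniv.smul_const c
        (mdifferentiableAt_mulInvariant η (1 : G)) (Set.mem_univ _)
      rw [algConnection, mulInvariantVectorField_smul, h]
      rfl)

@[simp] lemma algConnectionL_apply (ξ η : TangentSpace I (1 : G)) :
    algConnectionL I G ξ η = algConnection I ξ η := rfl

lemma leviCivita_ofBody (hinv : IsLeftInvariantMetric I G)
    {w : G → TangentSpace I (1 : G)} {x : G}
    (hw : MDifferentiableAt I 𝓘(ℝ, TangentSpace I (1 : G)) w x) (v : TangentSpace I x) :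
    leviCivita I G (fun y ↦ ofBody I y (w y)) x v
      = ofBody I x (mvfderiv I w x v + algConnection I (toBody I x v) (w x)) := by
  let e := stdOrthonormalBasis ℝ (TangentSpace I (1 : G))
  have h (ξ : TangentSpace I (1 : G)) : leviCivita I G (mulInvariantVectorField ξ) x v
      = ofBody I x (algConnection I (toBody I x v) ξ) := by
    rw [← leviCivita_mulInvariant hinv, ofBody_toBody]
  have hsum : (fun y ↦ ofBody I y (w y))
      = fun y ↦ ∑ i, (inner ℝ (e i) (w y) : ℝ) • mulInvariantVectorField (e i) y :=
    funext fun y ↦ ofBody_eq_sum e y (w y)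
  rw [hsum, CovariantDerivative.sum_smul _ _ (fun i ↦ mdifferentiableAt_inner_const hw (e i))
    (fun i ↦ mdifferentiableAt_mulInvariant _ _), Finset.sum_add_distrib, map_add, add_comm]
  congr 1
  · rw [ofBody_eq_sum e]
    exact Finset.sum_congr rfl fun i _ ↦ by rw [mvfderiv_inner_const hw]
  · simp only [h, ← map_smul, ← map_sum]
    congr 1
    simp only [← algConnectionL_apply]
    conv_rhs => rw [← e.sum_repr' (w x), map_sum]
    simp only [map_smul]

lemma leviCivita_eq_ofBody (hinv : IsLeftInvariantMetric I G)
    {Y : Π x : G, TangentSpace I x} {x : G} (hY : MDiffAt (T% Y) x) (v : TangentSpace I x) :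
    leviCivita I G Y x v = ofBody I x (mvfderiv I (fun y ↦ toBody I y (Y y)) x v
      + algConnection I (toBody I x v) (toBody I x (Y x))) := by
  rw [← leviCivita_ofBody hinv (mdifferentiableAt_toBody hinv hY)]
  simp only [ofBody_toBody]

omit [FiniteDimensional ℝ E] [Group G] [RiemannianBundle (fun x : G ↦ TangentSpace I x)]
  [LieGroup I ∞ G] [IsContMDiffRiemannianBundle I ∞ E (fun x : G ↦ TangentSpace I x)] in
lemma hasDerivWithinAt_comp_velocity {F : Type*} [NormedAddCommGroup F] [NormedSpace ℝ F]
    {q : ℝ → G} {J : Set ℝ} {t : ℝ} (hq : MDifferentiableWithinAt 𝓘(ℝ, ℝ) I q J t)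
    {c : G → F} (hc : MDifferentiableAt I 𝓘(ℝ, F) c (q t)) :
    HasDerivWithinAt (fun r ↦ c (q r)) (mvfderiv I c (q t) (velocity I q J t)) J t := by
  have h := (hc.hasMFDerivAt.comp_hasMFDerivWithinAt t hq.hasMFDerivWithinAt)
  have h' : HasFDerivWithinAt (fun r ↦ c (q r))
      ((mvfderiv I c (q t)).comp (mfderivWithin 𝓘(ℝ, ℝ) I q J t) : ℝ →L[ℝ] F) J t :=
    hasMFDerivWithinAt_iff_hasFDerivWithinAt.1 h
  exact h'.hasDerivWithinAt

/-- The covariant derivative along a curve in a left-invariant frame. -/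
lemma covDerivAlong_eq_ofBody (hinv : IsLeftInvariantMetric I G)
    {q : ℝ → G} {J : Set ℝ} {t : ℝ} (htJ : t ∈ J) (ht : UniqueDiffWithinAt ℝ J t)
    (hq : MDifferentiableWithinAt 𝓘(ℝ, ℝ) I q J t)
    {W : Π r : ℝ, TangentSpace I (q r)} {w : ℝ → TangentSpace I (1 : G)}
    (hw : DifferentiableWithinAt ℝ w J t) (hW : ∀ r ∈ J, W r = ofBody I (q r) (w r)) :
    covDerivAlong I q J W t = ofBody I (q t)
      (derivWithin w J t + algConnection I (toBody I (q t) (velocity I q J t)) (w t)) := by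
  let e := stdOrthonormalBasis ℝ (TangentSpace I (1 : G))
  let T := trivializationAt E (TangentSpace I : G → Type _) (q t)
  have hx : q t ∈ T.baseSet := FiberBundle.mem_baseSet_trivializationAt' (q t)
  let c (ξ : TangentSpace I (1 : G)) (y : G) : E := (T ⟨y, ofBody I y ξ⟩).2
  have hc (ξ) : MDifferentiableAt I 𝓘(ℝ, E) (c ξ) (q t) := by
    have := mdifferentiableAt_mulInvariant ξ (q t)
    rw [mdifferentiableAt_totalSpace] at this
    exact this.2
  have hsum {y : G} (hy : y ∈ T.baseSet) (ξ : TangentSpace I (1 : G)) :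
      c ξ y = ∑ i, (inner ℝ (e i) ξ : ℝ) • c (e i) y := by
    have hlin (v : TangentSpace I y) : (T ⟨y, v⟩).2 = T.linearMapAt ℝ y v := by
      rw [T.coe_linearMapAt_of_mem hy]
    simp only [c, hlin]
    conv_lhs => rw [← e.sum_repr' ξ]
    simp only [map_sum, map_smul]
  have hc' (i) : MDifferentiableAt I 𝓘(ℝ, E) (c (e i)) (q t) := hc (e i)
  have hWt : W t = mulInvariantVectorField (w t) (q t) := hW t htJ
  have hmem : ∀ᶠ r in nhdsWithin t J, q r ∈ T.baseSet :=
    hq.continuousWithinAt (T.open_baseSet.mem_nhds hx)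
  have hder : HasDerivWithinAt (fun r ↦ (T ⟨q r, W r⟩).2)
      (c (derivWithin w J t) (q t) + mvfderiv I (c (w t)) (q t) (velocity I q J t)) J t := by
    have hwi (i) : HasDerivWithinAt (fun r ↦ (inner ℝ (e i) (w r) : ℝ))
        (inner ℝ (e i) (derivWithin w J t)) J t :=
      (innerSL ℝ (e i)).hasFDerivAt.comp_hasDerivWithinAt t hw.hasDerivWithinAt
    have h1 := HasDerivWithinAt.fun_sum (u := Finset.univ) fun i _ ↦
      (hwi i).smul (hasDerivWithinAt_comp_velocity hq (hc' i))
    have hval : (c (derivWithin w J t) (q t) + mvfderiv I (c (w t)) (q t) (velocity I q J t))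
        = ∑ i, ((inner ℝ (e i) (w t) : ℝ) • mvfderiv I (c (e i)) (q t) (velocity I q J t)
          + (inner ℝ (e i) (derivWithin w J t) : ℝ) • c (e i) (q t)) := by
      have hloc : c (w t) =ᶠ[nhds (q t)] fun y ↦ ∑ i, (inner ℝ (e i) (w t) : ℝ) • c (e i) y :=
        Filter.eventually_of_mem (T.open_baseSet.mem_nhds hx) fun y hy ↦ hsum hy _
      have hd' : mvfderiv I (c (w t)) (q t) (velocity I q J t)
          = ∑ i, (inner ℝ (e i) (w t) : ℝ) • mvfderiv I (c (e i)) (q t) (velocity I q J t) := by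
        rw [mvfderiv_congr_of_eventuallyEq hloc, mvfderiv_fun_sum_const_smul _ _ hc']
      rw [Finset.sum_add_distrib, ← hd', hsum hx, add_comm]
    rw [hval]
    refine h1.congr_of_eventuallyEq_of_mem ?_ htJ
    filter_upwards [hmem, self_mem_nhdsWithin] with r hr hrJ
    rw [hW r hrJ]
    exact hsum hr (w r)
  have hconn := (leviCivita I G).eq_symm_mvfderiv_add_extend
    (mdifferentiableAt_mulInvariant (w t) (q t)) (velocity I q J t)
  rw [covDerivAlong, hder.derivWithin ht, hWt]
  have hadd (u v : E) : T.symm (q t) (u + v) = T.symm (q t) u + T.symm (q t) v := by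
    simp only [← T.coe_symmₗ (R := ℝ) hx, map_add]
  change T.symm (q t) _ + _ = _
  rw [hadd, add_assoc]
  have h3 : T.symm (q t) (c (derivWithin w J t) (q t)) = ofBody I (q t) (derivWithin w J t) :=
    T.symm_apply_apply_mk hx _
  rw [h3, map_add]
  congr 1
  refine hconn.symm.trans ?_
  rw [← leviCivita_mulInvariant hinv, ofBody_toBody]

end CovariantDerivatives

section Commutator

variable {E : Type*} [NormedAddCommGroup E] [NormedSpace ℝ E]
  {H : Type*} [TopologicalSpace H] {I : ModelWithCorners ℝ E H}
  {M : Type*} [TopologicalSpace M] [ChartedSpace H M] [IsManifold I ∞ M]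

lemma eventually_mdifferentiableAt_of_contMDiffAt {F : Type*} [NormedAddCommGroup F]
    [NormedSpace ℝ F] {f : M → F} {x : M} (hf : ContMDiffAt I 𝓘(ℝ, F) 2 f x) :
    ∀ᶠ y in nhds x, MDifferentiableAt I 𝓘(ℝ, F) f y :=
  ((contMDiffAt_iff_contMDiffAt_nhds (by simp)).1 hf).mono fun _ hy ↦ hy.mdifferentiableAt (by simp)

lemma eventually_mdifferentiableAt_section {X : Π x : M, TangentSpace I x} {x : M}
    (hX : ContMDiffAt I I.tangent 2 (T% X) x) : ∀ᶠ y in nhds x, MDiffAt (T% X) y :=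
  ((contMDiffAt_iff_contMDiffAt_nhds (by simp)).1 hX).mono fun _ hy ↦ hy.mdifferentiableAt (by simp)

lemma mlieBracket_smul_right_eventuallyEq [CompleteSpace E] {f : M → ℝ}
    {Y W : Π x : M, TangentSpace I x} {x : M} (hf : ContMDiffAt I 𝓘(ℝ, ℝ) 2 f x)
    (hW : ContMDiffAt I I.tangent 2 (T% W) x) :
    mlieBracket I Y (f • W) =ᶠ[nhds x]
      (fun y ↦ mvfderiv I f y (Y y)) • W + f • mlieBracket I Y W := by
  filter_upwards [eventually_mdifferentiableAt_of_contMDiffAt hf,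
    eventually_mdifferentiableAt_section hW] with y hy hWy
  rw [mlieBracket_smul_right hy hWy]
  rfl

lemma mdifferentiableAt_mlieBracket [CompleteSpace E] {X Y : Π x : M, TangentSpace I x} {x : M}
    (hX : ContMDiffAt I I.tangent 2 (T% X) x) (hY : ContMDiffAt I I.tangent 2 (T% Y) x) :
    MDiffAt (T% (mlieBracket I X Y)) x := by
  have : IsManifold I ((2 : ℕ∞) + 1) M := IsManifold.of_le (n := ∞) (by norm_cast)
  have : IsManifold I (minSmoothness ℝ 2) M :=
    IsManifold.of_le (n := ∞) (by simp only [minSmoothness_of_isRCLikeNormedField]; norm_cast)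
  have h := ContMDiffAt.mlieBracket_vectorField (m := 1) (n := 2) hX hY
    (by simp only [minSmoothness_of_isRCLikeNormedField]; norm_cast)
  exact h.mdifferentiableAt (by simp)

variable [FiniteDimensional ℝ E] [RiemannianBundle (fun x : M ↦ TangentSpace I x)]
  [IsContMDiffRiemannianBundle I ∞ E (fun x : M ↦ TangentSpace I x)]

lemma mdifferentiableAt_mvfderiv_apply {f : M → ℝ}
    {Y W : Π x : M, TangentSpace I x} {x : M} (hf : ContMDiffAt I 𝓘(ℝ, ℝ) 2 f x)
    (hY : ContMDiffAt I I.tangent 2 (T% Y) x) (hW : ContMDiffAt I I.tangent 2 (T% W) x)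
    (hW1 : ∀ y, (inner ℝ (W y) (W y) : ℝ) = 1) :
    MDifferentiableAt I 𝓘(ℝ, ℝ) (fun y ↦ mvfderiv I f y (Y y)) x := by
  have : CompleteSpace E := FiniteDimensional.complete ℝ E
  have hWd := hW.mdifferentiableAt (by simp)
  have hfd := hf.mdifferentiableAt (by simp)
  have h := mdifferentiableAt_inner (mdifferentiableAt_mlieBracket hY (hf.smul_section hW)) hWd
  have h' := mdifferentiableAt_inner
    (hfd.smul_section (mdifferentiableAt_mlieBracket hY hW)) hWd
  refine (h.sub h').congr_of_eventuallyEq ?_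
  filter_upwards [mlieBracket_smul_right_eventuallyEq (Y := Y) hf hW] with y hy
  simp only [Pi.sub_apply, hy, Pi.add_apply, Pi.smul_apply', inner_add_left,
    real_inner_smul_left, hW1]
  ring

/-- The Lie bracket of vector fields is the commutator of the derivations they define. -/
lemma mvfderiv_mlieBracket {f : M → ℝ}
    {X Y W : Π x : M, TangentSpace I x} {x : M} (hf : ContMDiffAt I 𝓘(ℝ, ℝ) 2 f x)
    (hX : ContMDiffAt I I.tangent 2 (T% X) x) (hY : ContMDiffAt I I.tangent 2 (T% Y) x)
    (hW : ContMDiffAt I I.tangent 2 (T% W) x) (hW1 : ∀ y, (inner ℝ (W y) (W y) : ℝ) = 1) :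
    mvfderiv I f x (mlieBracket I X Y x) = mvfderiv I (fun y ↦ mvfderiv I f y (Y y)) x (X x)
      - mvfderiv I (fun y ↦ mvfderiv I f y (X y)) x (Y x) := by
  have : CompleteSpace E := FiniteDimensional.complete ℝ E
  have : IsManifold I (minSmoothness ℝ 3) M :=
    IsManifold.of_le (n := ∞) (by simp only [minSmoothness_of_isRCLikeNormedField]; norm_cast)
  have hWd := hW.mdifferentiableAt (by simp)
  have hfd := hf.mdifferentiableAt (by simp)
  have expand {X Y : Π x : M, TangentSpace I x} (hX : ContMDiffAt I I.tangent 2 (T% X) x)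
      (hY : ContMDiffAt I I.tangent 2 (T% Y) x) :
      mlieBracket I X (mlieBracket I Y (f • W)) x =
        mvfderiv I (fun y ↦ mvfderiv I f y (Y y)) x (X x) • W x
        + mvfderiv I f x (Y x) • mlieBracket I X W x
        + mvfderiv I f x (X x) • mlieBracket I Y W x
        + f x • mlieBracket I X (mlieBracket I Y W) x := by
    have hd := mdifferentiableAt_mvfderiv_apply hf hY hW hW1
    rw [Filter.EventuallyEq.mlieBracket_vectorField_eq (Filter.EventuallyEq.refl _ X)
      (mlieBracket_smul_right_eventuallyEq (Y := Y) hf hW),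
      mlieBracket_add_right (hd.smul_section hWd)
        (hfd.smul_section (mdifferentiableAt_mlieBracket hY hW)),
      mlieBracket_smul_right hd hWd,
      mlieBracket_smul_right hfd (mdifferentiableAt_mlieBracket hY hW)]
    abel
  have hmin : minSmoothness ℝ 2 = 2 := minSmoothness_of_isRCLikeNormedField
  have j1 := leibniz_identity_mlieBracket_apply (I := I) (U := X) (V := Y) (W := f • W) (x := x)
    (by rw [hmin]; exact hX) (by rw [hmin]; exact hY) (by rw [hmin]; exact hf.smul_section hW)
  have j2 := leibniz_identity_mlieBracket_apply (I := I) (U := X) (V := Y) (W := W) (x := x)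
    (by rw [hmin]; exact hX) (by rw [hmin]; exact hY) (by rw [hmin]; exact hW)
  rw [expand hX hY, expand hY hX, mlieBracket_smul_right hfd hWd, j2] at j1
  have j3 := congrArg (fun v ↦ (inner ℝ v (W x) : ℝ)) j1
  simp only [inner_add_left, real_inner_smul_left, hW1] at j3
  linarith

end Commutator

section Curvature

section Bilinear

variable {E : Type*} [NormedAddCommGroup E] [NormedSpace ℝ E]
  {H : Type*} [TopologicalSpace H] {I : ModelWithCorners ℝ E H}
  {M : Type*} [TopologicalSpace M] [ChartedSpace H M]
  {F : Type*} [NormedAddCommGroup F] [NormedSpace ℝ F]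

lemma mdifferentiableAt_bilin (B : F →L[ℝ] F →L[ℝ] F) {y z : M → F} {p : M}
    (hy : MDifferentiableAt I 𝓘(ℝ, F) y p) (hz : MDifferentiableAt I 𝓘(ℝ, F) z p) :
    MDifferentiableAt I 𝓘(ℝ, F) (fun q ↦ B (y q) (z q)) p :=
  (B.isBoundedBilinearMap.differentiableAt (y p, z p)).mdifferentiableAt.comp p
    (hy.prodMk_space hz)

lemma mvfderiv_bilin (B : F →L[ℝ] F →L[ℝ] F) {y z : M → F} {p : M}
    (hy : MDifferentiableAt I 𝓘(ℝ, F) y p) (hz : MDifferentiableAt I 𝓘(ℝ, F) z p)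
    (v : TangentSpace I p) :
    mvfderiv I (fun q ↦ B (y q) (z q)) p v
      = B (y p) (mvfderiv I z p v) + B (mvfderiv I y p v) (z p) := by
  have hyz : HasMFDerivAt I 𝓘(ℝ, F × F) (fun q ↦ (y q, z q)) p
      ((mvfderiv I y p).prod (mvfderiv I z p)) :=
    ⟨hy.continuousAt.prodMk hz.continuousAt, hy.hasMFDerivAt.2.prodMk hz.hasMFDerivAt.2⟩
  have h := (B.isBoundedBilinearMap.hasFDerivAt (y p, z p)).hasMFDerivAt.comp p hyz
  exact congr($(h.mfderiv) v)

end Bilinear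

variable {E : Type*} [NormedAddCommGroup E] [NormedSpace ℝ E]
  {H : Type*} [TopologicalSpace H] {I : ModelWithCorners ℝ E H}
  {G : Type*} [TopologicalSpace G] [ChartedSpace H G] [Group G]
  [RiemannianBundle (fun x : G ↦ TangentSpace I x)] [LieGroup I ∞ G]

variable [FiniteDimensional ℝ E]
  [IsContMDiffRiemannianBundle I ∞ E (fun x : G ↦ TangentSpace I x)]

section Vector

variable {z : G → TangentSpace I (1 : G)} {X Y Z : Π x : G, TangentSpace I x} {x : G}

omit [Group G] [RiemannianBundle (fun x : G ↦ TangentSpace I x)] [LieGroup I ∞ G]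
  [FiniteDimensional ℝ E] [IsContMDiffRiemannianBundle I ∞ E (fun x : G ↦ TangentSpace I x)] in
lemma contMDiffAt_inner_const {g' : Type*} [NormedAddCommGroup g'] [InnerProductSpace ℝ g']
    {w : G → g'} (hw : ContMDiffAt I 𝓘(ℝ, g') 2 w x) (c : g') :
    ContMDiffAt I 𝓘(ℝ, ℝ) 2 (fun y ↦ (inner ℝ c (w y) : ℝ)) x :=
  (innerSL ℝ c).contMDiff.contMDiffAt.comp x hw

omit [FiniteDimensional ℝ E] [IsContMDiffRiemannianBundle I ∞ E (fun x : G ↦ TangentSpace I x)]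
  in
lemma mvfderiv_apply_inner_eventuallyEq (hz : ContMDiffAt I 𝓘(ℝ, TangentSpace I (1 : G)) 2 z x)
    (Y : Π x : G, TangentSpace I x) (c : TangentSpace I (1 : G)) :
    (fun y ↦ mvfderiv I (fun y' ↦ (inner ℝ c (z y') : ℝ)) y (Y y)) =ᶠ[nhds x]
      fun y ↦ inner ℝ c (mvfderiv I z y (Y y)) := by
  filter_upwards [eventually_mdifferentiableAt_of_contMDiffAt hz] with y hy
  exact mvfderiv_inner_const hy c (Y y)

omit [LieGroup I ∞ G] [FiniteDimensional ℝ E]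
  [IsContMDiffRiemannianBundle I ∞ E (fun x : G ↦ TangentSpace I x)] in
lemma inner_mulInvariantVectorField_self (hinv : IsLeftInvariantMetric I G) {ι : Type*} [Fintype ι]
    (e : OrthonormalBasis ι ℝ (TangentSpace I (1 : G))) (i : ι) (y : G) :
    (inner ℝ (mulInvariantVectorField (e i) y : TangentSpace I y)
      (mulInvariantVectorField (e i) y) : ℝ) = 1 := by
  rw [mulInvariantVectorField_eq_ofBody, hinv.inner_ofBody, real_inner_self_eq_norm_sq,
    e.orthonormal.1 i]
  norm_num

omit [RiemannianBundle (fun x : G ↦ TangentSpace I x)] [FiniteDimensional ℝ E]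
  [IsContMDiffRiemannianBundle I ∞ E (fun x : G ↦ TangentSpace I x)] in
lemma contMDiffAt_two_mulInvariantVectorField (ξ : TangentSpace I (1 : G)) (x : G) :
    ContMDiffAt I I.tangent 2
      (T% (mulInvariantVectorField ξ : Π x : G, TangentSpace I x)) x :=
  (contMDiff_mulInvariantVectorField_infty ξ).contMDiffAt.of_le (by norm_cast)

lemma mdifferentiableAt_mvfderiv_apply_vector (hinv : IsLeftInvariantMetric I G)
    (hz : ContMDiffAt I 𝓘(ℝ, TangentSpace I (1 : G)) 2 z x)
    (hY : ContMDiffAt I I.tangent 2 (T% Y) x) :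
    MDifferentiableAt I 𝓘(ℝ, TangentSpace I (1 : G)) (fun y ↦ mvfderiv I z y (Y y)) x := by
  let e := stdOrthonormalBasis ℝ (TangentSpace I (1 : G))
  have h (i) : MDifferentiableAt I 𝓘(ℝ, TangentSpace I (1 : G))
      (fun y ↦ (inner ℝ (e i) (mvfderiv I z y (Y y)) : ℝ) • e i) x := by
    refine MDifferentiableAt.smul ?_ mdifferentiableAt_const
    refine (mdifferentiableAt_mvfderiv_apply (contMDiffAt_inner_const hz (e i)) hY
      (contMDiffAt_two_mulInvariantVectorField (e i) x)
      (inner_mulInvariantVectorField_self hinv e i)).congr_of_eventuallyEq ?_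
    exact (mvfderiv_apply_inner_eventuallyEq hz Y (e i)).symm
  have hsum := MDifferentiableAt.sum (t := Finset.univ) fun i _ ↦ h i
  convert! hsum using 1
  ext y
  simp [e.sum_repr']

lemma mvfderiv_mlieBracket_vector (hinv : IsLeftInvariantMetric I G)
    (hz : ContMDiffAt I 𝓘(ℝ, TangentSpace I (1 : G)) 2 z x)
    (hX : ContMDiffAt I I.tangent 2 (T% X) x) (hY : ContMDiffAt I I.tangent 2 (T% Y) x) :
    mvfderiv I z x (mlieBracket I X Y x) = mvfderiv I (fun y ↦ mvfderiv I z y (Y y)) x (X x)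
      - mvfderiv I (fun y ↦ mvfderiv I z y (X y)) x (Y x) := by
  let e := stdOrthonormalBasis ℝ (TangentSpace I (1 : G))
  refine InnerProductSpace.ext_inner_left_basis e.toBasis (𝕜 := ℝ) fun i ↦ ?_
  rw [e.coe_toBasis, inner_sub_right, ← mvfderiv_inner_const (hz.mdifferentiableAt (by simp)),
    ← mvfderiv_inner_const (mdifferentiableAt_mvfderiv_apply_vector hinv hz hY),
    ← mvfderiv_inner_const (mdifferentiableAt_mvfderiv_apply_vector hinv hz hX),
    ← mvfderiv_congr_of_eventuallyEq (mvfderiv_apply_inner_eventuallyEq hz Y (e i)),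
    ← mvfderiv_congr_of_eventuallyEq (mvfderiv_apply_inner_eventuallyEq hz X (e i))]
  exact mvfderiv_mlieBracket (contMDiffAt_inner_const hz (e i)) hX hY
    (contMDiffAt_two_mulInvariantVectorField (e i) x) (inner_mulInvariantVectorField_self hinv e i)

lemma toBody_mlieBracket (hinv : IsLeftInvariantMetric I G)
    (hX : MDiffAt (T% X) x) (hY : MDiffAt (T% Y) x) :
    toBody I x (mlieBracket I X Y x) =
      mvfderiv I (fun y ↦ toBody I y (Y y)) x (X x) - mvfderiv I (fun y ↦ toBody I y (X y)) x (Y x)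
        + algConnection I (toBody I x (X x)) (toBody I x (Y x))
        - algConnection I (toBody I x (Y x)) (toBody I x (X x)) := by
  have : CompleteSpace E := FiniteDimensional.complete ℝ E
  have h := (CovariantDerivative.torsion_eq_zero_iff (leviCivita I G)).1 leviCivita_torsion hX hY
  rw [← h, leviCivita_eq_ofBody hinv hY, leviCivita_eq_ofBody hinv hX, map_sub, toBody_ofBody,
    toBody_ofBody]
  abel

variable (I) in
/-- The curvature in the left-invariant frame. -/
def algCurvature (ξ η ζ : TangentSpace I (1 : G)) : TangentSpace I (1 : G) :=
  algConnection I ξ (algConnection I η ζ) - algConnection I η (algConnection I ξ ζ)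
    - algConnection I (algConnection I ξ η - algConnection I η ξ) ζ

lemma leviCivita_leviCivita (hinv : IsLeftInvariantMetric I G)
    (hY : ContMDiffAt I I.tangent 2 (T% Y) x) (hZ : ContMDiffAt I I.tangent 2 (T% Z) x)
    (v : TangentSpace I x) :
    leviCivita I G (fun y ↦ leviCivita I G Z y (Y y)) x v = ofBody I x
      (mvfderiv I (fun y ↦ mvfderiv I (fun y' ↦ toBody I y' (Z y')) y (Y y)) x v
        + algConnection I (toBody I x (Y x)) (mvfderiv I (fun y ↦ toBody I y (Z y)) x v)
        + algConnection I (mvfderiv I (fun y ↦ toBody I y (Y y)) x v) (toBody I x (Z x))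
        + algConnection I (toBody I x v) (mvfderiv I (fun y ↦ toBody I y (Z y)) x (Y x))
        + algConnection I (toBody I x v)
          (algConnection I (toBody I x (Y x)) (toBody I x (Z x)))) := by
  let y : G → TangentSpace I (1 : G) := fun q ↦ toBody I q (Y q)
  let z : G → TangentSpace I (1 : G) := fun q ↦ toBody I q (Z q)
  have hz : ContMDiffAt I 𝓘(ℝ, TangentSpace I (1 : G)) 2 z x :=
    contMDiffWithinAt_toBody (n := 2) hinv hZ
  have hyd : MDifferentiableAt I 𝓘(ℝ, TangentSpace I (1 : G)) y x :=
    mdifferentiableAt_toBody hinv (hY.mdifferentiableAt (by simp))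
  have hzd : MDifferentiableAt I 𝓘(ℝ, TangentSpace I (1 : G)) z x :=
    mdifferentiableAt_toBody hinv (hZ.mdifferentiableAt (by simp))
  have hd := mdifferentiableAt_mvfderiv_apply_vector hinv hz hY
  have hB := mdifferentiableAt_bilin (algConnectionL I G) hyd hzd
  let u : G → TangentSpace I (1 : G) :=
    fun q ↦ mvfderiv I z q (Y q) + algConnectionL I G (y q) (z q)
  have hu : MDifferentiableAt I 𝓘(ℝ, TangentSpace I (1 : G)) u x := hd.add hB
  have hev : ∀ᶠ q in nhds x, leviCivita I G Z q (Y q) = ofBody I q (u q) := by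
    filter_upwards [eventually_mdifferentiableAt_section hZ] with q hq
    exact leviCivita_eq_ofBody hinv hq (Y q)
  have hou := mdifferentiableAt_ofBody hu
  have hcongr := (leviCivita I G).isCovariantDerivativeOnUniv.congr_of_eventuallyEq
    (σ := fun y ↦ leviCivita I G Z y (Y y)) (σ' := fun q ↦ ofBody I q (u q))
    (hou.congr_of_eventuallyEq (hev.mono fun q hq ↦ by simp only [hq])) hou Filter.univ_mem hev
  rw [hcongr, leviCivita_ofBody hinv hu]
  congr 1
  have hdu : mvfderiv I u x v = mvfderiv I (fun q ↦ mvfderiv I z q (Y q)) x v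
      + (algConnectionL I G (y x) (mvfderiv I z x v)
        + algConnectionL I G (mvfderiv I y x v) (z x)) := by
    rw [← mvfderiv_bilin (algConnectionL I G) hyd hzd, ← add_apply, ← mvfderiv_fun_add hd hB]
  rw [hdu, ← algConnectionL_apply (toBody I x v) (u x), map_add]
  simp only [algConnectionL_apply]
  simp only [y, z]
  abel

lemma curvatureField_eq_ofBody (hinv : IsLeftInvariantMetric I G)
    (hX : ContMDiffAt I I.tangent 2 (T% X) x) (hY : ContMDiffAt I I.tangent 2 (T% Y) x)
    (hZ : ContMDiffAt I I.tangent 2 (T% Z) x) :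
    curvatureField I X Y Z x = ofBody I x
      (algCurvature I (toBody I x (X x)) (toBody I x (Y x)) (toBody I x (Z x))) := by
  have hz : ContMDiffAt I 𝓘(ℝ, TangentSpace I (1 : G)) 2 (fun q ↦ toBody I q (Z q)) x :=
    contMDiffWithinAt_toBody (n := 2) hinv hZ
  rw [curvatureField, leviCivita_leviCivita hinv hY hZ, leviCivita_leviCivita hinv hX hZ,
    leviCivita_eq_ofBody hinv (hZ.mdifferentiableAt (by simp)),
    mvfderiv_mlieBracket_vector hinv hz hX hY,
    toBody_mlieBracket hinv (hX.mdifferentiableAt (by simp)) (hY.mdifferentiableAt (by simp)),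
    ← map_sub, ← map_sub]
  congr 1
  simp only [algCurvature, ← algConnectionL_apply, map_add, map_sub, add_apply, sub_apply]
  abel

end Vector

/-- The curvature is invariant under left translations. -/
lemma curvature_ofBody (hinv : IsLeftInvariantMetric I G) (x : G)
    (ξ η ζ : TangentSpace I (1 : G)) :
    curvature I x (ofBody I x ξ) (ofBody I x η) (ofBody I x ζ)
      = ofBody I x (curvature I (1 : G) ξ η ζ) := by
  have key (x : G) (u v w : TangentSpace I x) : curvature I x u v w
      = ofBody I x (algCurvature I (toBody I x u) (toBody I x v) (toBody I x w)) := by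
    rw [curvature, curvatureField_eq_ofBody hinv (FiberBundle.contMDiffAt_extend I E u)
      (FiberBundle.contMDiffAt_extend I E v) (FiberBundle.contMDiffAt_extend I E w)]
    simp only [FiberBundle.extend_apply_self]
  have h1 (ξ : TangentSpace I (1 : G)) : toBody I 1 ξ = ξ := by
    conv_lhs => rw [← ofBody_one I ξ]
    exact toBody_ofBody I 1 ξ
  simp only [key, toBody_ofBody, h1, ofBody_one]

end Curvature

section Velocity

variable {E : Type*} [NormedAddCommGroup E] [NormedSpace ℝ E]
  {H : Type*} [TopologicalSpace H] {I : ModelWithCorners ℝ E H}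
  {G : Type*} [TopologicalSpace G] [ChartedSpace H G] [Group G] [LieGroup I ∞ G]

lemma velocity_mul_left (k : G) {γ : ℝ → G} {J : Set ℝ} {t : ℝ}
    (ht : UniqueDiffWithinAt ℝ J t) (hγ : MDifferentiableWithinAt 𝓘(ℝ, ℝ) I γ J t) :
    velocity I (fun r ↦ k * γ r) J t = leftTranslate I k (velocity I γ J t) := by
  have h := mfderiv_comp_mfderivWithin t (mdifferentiableAt_mul_left (I := I) k (γ t)) hγ
    ht.uniqueMDiffWithinAt
  exact congr($h (1 : ℝ))

end Velocity

section Invariance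

variable {E : Type*} [NormedAddCommGroup E] [NormedSpace ℝ E]
  {H : Type*} [TopologicalSpace H] {I : ModelWithCorners ℝ E H}
  {G : Type*} [TopologicalSpace G] [ChartedSpace H G] [Group G]
  [RiemannianBundle (fun x : G ↦ TangentSpace I x)]

lemma IsLeftInvariantMetric.enorm_leftTranslate (hinv : IsLeftInvariantMetric I G) (k : G) {h : G}
    (v : TangentSpace I h) : ‖leftTranslate I k v‖ₑ = ‖v‖ₑ := by
  have h1 := hinv k h v v
  rw [real_inner_self_eq_norm_sq, real_inner_self_eq_norm_sq] at h1
  have h2 : ‖leftTranslate I k v‖ = ‖v‖ :=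
    (sq_eq_sq₀ (norm_nonneg _) (norm_nonneg _)).1 h1
  rw [enorm_eq_nnnorm, enorm_eq_nnnorm, ENNReal.coe_inj]
  exact NNReal.eq h2

variable [LieGroup I ∞ G]

lemma riemannianEDist_mul_left_le (hinv : IsLeftInvariantMetric I G) (k x y : G) :
    riemannianEDist I (k * x) (k * y) ≤ riemannianEDist I x y := by
  refine le_of_forall_gt fun r hr ↦ ?_
  obtain ⟨γ, h0, h1, hγ, hlt⟩ := exists_lt_of_riemannianEDist_lt hr
  have hsm : ContMDiffOn 𝓘(ℝ, ℝ) I 1 (fun t ↦ k * γ t) (Set.Icc 0 1) :=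
    ((contMDiff_mul_left (I := I) (n := ∞) (a := k)).of_le (by norm_cast)).comp_contMDiffOn hγ
  refine lt_of_le_of_lt (riemannianEDist_le_pathELength hsm (by rw [h0]) (by rw [h1])
    zero_le_one) ?_
  refine lt_of_le_of_lt (le_of_eq ?_) hlt
  rw [pathELength_eq_lintegral_mfderivWithin_Icc, pathELength_eq_lintegral_mfderivWithin_Icc]
  refine MeasureTheory.setLIntegral_congr_fun measurableSet_Icc fun t ht ↦ ?_
  have hv := velocity_mul_left (I := I) k (uniqueDiffOn_Icc (zero_lt_one' ℝ) t ht)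
    ((hγ t ht).mdifferentiableWithinAt one_ne_zero)
  have := hinv.enorm_leftTranslate k (velocity I γ (Set.Icc 0 1) t)
  rw [← hv] at this
  exact this

lemma riemannianDist_mul_left (hinv : IsLeftInvariantMetric I G) (k x y : G) :
    riemannianDist I (k * x) (k * y) = riemannianDist I x y := by
  rw [riemannianDist, riemannianDist]
  congr 1
  refine le_antisymm (riemannianEDist_mul_left_le hinv k x y) ?_
  simpa using riemannianEDist_mul_left_le hinv k⁻¹ (k * x) (k * y)

variable [FiniteDimensional ℝ E]

omit [Group G] [LieGroup I ∞ G] in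
lemma inner_gradient (U : G → ℝ) (x : G) (v : TangentSpace I x) :
    (inner ℝ (gradient I U x) v : ℝ) = mvfderiv I U x v := by
  rw [gradient, InnerProductSpace.toDual_symm_apply]

lemma gradient_comp_mul_left (hinv : IsLeftInvariantMetric I G) {U : G → ℝ} {x : G}
    (hU : MDifferentiableAt I 𝓘(ℝ, ℝ) U x) :
    gradient I U x = ofBody I x (gradient I (fun z ↦ U (x * z)) 1) := by
  refine ext_inner_right ℝ fun w ↦ ?_
  rw [← ofBody_toBody I x w, hinv.inner_ofBody, inner_gradient, inner_gradient]
  have key : ∀ z : G, x * 1 = z → MDifferentiableAt I 𝓘(ℝ, ℝ) U z →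
      ∀ (A : TangentSpace I (1 : G) →L[ℝ] TangentSpace I z),
      A = mfderiv I I (fun y : G ↦ x * y) 1 →
      mvfderiv I U z (A (toBody I x w)) = mvfderiv I (fun z ↦ U (x * z)) 1 (toBody I x w) := by
    rintro z rfl hU A rfl
    exact (mvfderiv_comp_apply (1 : G) hU (mdifferentiableAt_mul_left x 1) _).symm
  exact key x (mul_one x) hU _ rfl

lemma gradient₁_eq_ofBody (hinv : IsLeftInvariantMetric I G) {V : G → G → ℝ}
    (hV : ContMDiff (I.prod I) 𝓘(ℝ, ℝ) ∞ (fun p : G × G ↦ V p.1 p.2))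
    (hVinv : ∀ k p q : G, V (k * p) (k * q) = V p q) (x y : G) :
    gradient₁ I V x y = ofBody I x (gradient₁ I V 1 (x⁻¹ * y)) := by
  have hsm : ContMDiff I 𝓘(ℝ, ℝ) ∞ (fun z ↦ V z y) :=
    hV.comp (contMDiff_id.prodMk contMDiff_const)
  rw [gradient₁, gradient_comp_mul_left hinv (hsm.contMDiffAt.mdifferentiableAt (by simp)),
    gradient₁]
  congr 2
  ext z
  rw [← hVinv x z, mul_inv_cancel_left]

end Invariance

section Reconstruction

variable {E : Type*} [NormedAddCommGroup E] [NormedSpace ℝ E]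
  {H : Type*} [TopologicalSpace H] {I : ModelWithCorners ℝ E H}
  {G : Type*} [TopologicalSpace G] [ChartedSpace H G] [Group G] [LieGroup I ∞ G]
  {g k h : ℝ → G} {J : Set ℝ} {t : ℝ}

/-- The product rule for curves in a Lie group. -/
lemma velocity_mul (ht : UniqueDiffWithinAt ℝ J t)
    (hg : MDifferentiableWithinAt 𝓘(ℝ, ℝ) I g J t)
    (hh : MDifferentiableWithinAt 𝓘(ℝ, ℝ) I h J t) :
    velocity I (fun r ↦ g r * h r) J t =
      mfderiv I I (fun z : G ↦ z * h t) (g t) (velocity I g J t)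
        + mfderiv I I (fun z : G ↦ g t * z) (h t) (velocity I h J t) := by
  have hmul : MDifferentiableAt (I.prod I) I (fun p : G × G ↦ p.1 * p.2) (g t, h t) :=
    (contMDiff_mul I ∞).mdifferentiableAt (by simp)
  have h1 := mfderiv_comp_mfderivWithin t hmul (hg.prodMk hh) ht.uniqueMDiffWithinAt
  have h2 := mfderiv_prod_eq_add_apply (v := ((velocity I g J t, velocity I h J t) : E × E)) hmul
  refine Eq.trans ?_ h2
  rw [mfderivWithin_prodMk hg hh ht.uniqueMDiffWithinAt] at h1
  exact congr($h1 (1 : ℝ))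

lemma mdifferentiableWithinAt_inv_mul (hg : MDifferentiableWithinAt 𝓘(ℝ, ℝ) I g J t)
    (hk : MDifferentiableWithinAt 𝓘(ℝ, ℝ) I k J t) :
    MDifferentiableWithinAt 𝓘(ℝ, ℝ) I (fun r ↦ (g r)⁻¹ * k r) J t := by
  have hi : MDifferentiableWithinAt 𝓘(ℝ, ℝ) I (fun r ↦ (g r)⁻¹) J t :=
    ((contMDiff_inv I ∞).mdifferentiableAt (by simp) (x := g t)).comp_mdifferentiableWithinAt t hg
  exact ((contMDiff_mul I ∞).mdifferentiableAt (by simp)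
    (x := ((g t)⁻¹, k t))).comp_mdifferentiableWithinAt t (hi.prodMk hk)

/-- The velocity of `g⁻¹ k` for two curves `g` and `k` in a Lie group. -/
lemma velocity_inv_mul (ht : UniqueDiffWithinAt ℝ J t)
    (hg : MDifferentiableWithinAt 𝓘(ℝ, ℝ) I g J t)
    (hk : MDifferentiableWithinAt 𝓘(ℝ, ℝ) I k J t) :
    velocity I (fun r ↦ (g r)⁻¹ * k r) J t =
      - rightMul I (bodyVelocity I g J t) ((g t)⁻¹ * k t)
        + mulInvariantVectorField (bodyVelocity I k J t) ((g t)⁻¹ * k t) := by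
  have hh := mdifferentiableWithinAt_inv_mul hg hk
  have ha : MDifferentiableWithinAt 𝓘(ℝ, ℝ) I (fun r ↦ (g t)⁻¹ * g r) J t :=
    (mdifferentiableAt_mul_left _ _).comp_mdifferentiableWithinAt t hg
  have h1 := velocity_mul ht ha hh
  rw [mfderiv_mul_left_of_eq_one I (inv_mul_cancel (g t)), velocity_mul_left _ ht hg] at h1
  have h2 : (fun r ↦ (g t)⁻¹ * g r * ((g r)⁻¹ * k r)) = fun r ↦ (g t)⁻¹ * k r := by
    ext r
    group
  have h3 := velocity_mul_left (I := I) (g t)⁻¹ ht hk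
  have h4 : (mulInvariantVectorField (bodyVelocity I k J t) ((g t)⁻¹ * k t) : E)
      = leftTranslate I (g t)⁻¹ (velocity I k J t) := by
    refine (ofBody_mul I (g t)⁻¹ (k t) _).trans ?_
    exact congrArg (mfderiv I I (fun y : G ↦ (g t)⁻¹ * y) (k t)) (ofBody_toBody I (k t) _)
  have h5 : (rightMul I (bodyVelocity I g J t) ((g t)⁻¹ * k t) : E)
      = mfderiv I I (fun z : G ↦ z * ((g t)⁻¹ * k t)) ((g t)⁻¹ * g t)
        (leftTranslate I (g t)⁻¹ (velocity I g J t)) := by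
    have key : ∀ z : G, z = 1 → ∀ ξ : E, (rightMul I (ξ : TangentSpace I (1 : G))
        ((g t)⁻¹ * k t) : E)
        = mfderiv I I (fun z : G ↦ z * ((g t)⁻¹ * k t)) z (ξ : TangentSpace I z) := by
      rintro z rfl ξ
      rfl
    exact key _ (inv_mul_cancel (g t)) _
  have h6 : (velocity I (fun r ↦ (g t)⁻¹ * g r * ((g r)⁻¹ * k r)) J t : E)
      = velocity I (fun r ↦ (g t)⁻¹ * k r) J t := by rw [h2]
  have h7 : (velocity I (fun r ↦ (g t)⁻¹ * k r) J t : E)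
      = (rightMul I (bodyVelocity I g J t) ((g t)⁻¹ * k t) : E)
        + velocity I (fun r ↦ (g r)⁻¹ * k r) J t := by
    rw [h5, ← h6]
    exact h1
  have h8 : (mulInvariantVectorField (bodyVelocity I k J t) ((g t)⁻¹ * k t) : E)
      = (rightMul I (bodyVelocity I g J t) ((g t)⁻¹ * k t) : E)
        + velocity I (fun r ↦ (g r)⁻¹ * k r) J t := by
    rw [← h7, h4]
    exact h3.symm
  exact eq_neg_add_of_add_eq h8.symm

end Reconstruction

section Reduction

variable {E : Type*} [NormedAddCommGroup E] [NormedSpace ℝ E] [FiniteDimensional ℝ E]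
  {H : Type*} [TopologicalSpace H] {I : ModelWithCorners ℝ E H}
  {G : Type*} [TopologicalSpace G] [ChartedSpace H G] [Group G] [LieGroup I ∞ G]
  [RiemannianBundle (fun x : G ↦ TangentSpace I x)]
  [IsContMDiffRiemannianBundle I ∞ E (fun x : G ↦ TangentSpace I x)]

omit [FiniteDimensional ℝ E] [RiemannianBundle (fun x : G ↦ TangentSpace I x)]
  [IsContMDiffRiemannianBundle I ∞ E (fun x : G ↦ TangentSpace I x)] in
lemma ofBody_bodyVelocity (q : ℝ → G) (J : Set ℝ) (t : ℝ) :
    ofBody I (q t) (bodyVelocity I q J t) = velocity I q J t :=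
  ofBody_toBody I (q t) _

lemma contDiffOn_bodyVelocity (hinv : IsLeftInvariantMetric I G) {q : ℝ → G} {J : Set ℝ}
    (hJ : UniqueDiffOn ℝ J) (hq : ContMDiffOn 𝓘(ℝ, ℝ) I ∞ q J) :
    ContDiffOn ℝ ∞ (bodyVelocity I q J) J := by
  rw [← contMDiffOn_iff_contDiffOn]
  intro t ht
  have hsec : ContMDiff 𝓘(ℝ, ℝ) 𝓘(ℝ, ℝ).tangent ∞
      (fun t : ℝ ↦ (⟨t, (1 : ℝ)⟩ : TangentBundle 𝓘(ℝ, ℝ) ℝ)) := by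
    exact (contMDiff_vectorSpace_iff_contDiff (V := fun _ : ℝ ↦ (1 : ℝ))).2 contDiff_const
  have hW : ContMDiffOn 𝓘(ℝ, ℝ) I.tangent ∞
      (fun t ↦ (⟨q t, velocity I q J t⟩ : TangentBundle I G)) J :=
    (hq.contMDiffOn_tangentMapWithin (m := ∞) le_rfl hJ.uniqueMDiffOn).comp hsec.contMDiffOn
      (fun t ht ↦ ht)
  exact contMDiffWithinAt_toBody (n := ⊤) hinv (hW t ht)

lemma contDiffOn_derivWithin_add_algConnection {J : Set ℝ} (hJ : UniqueDiffOn ℝ J)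
    {ξ η : ℝ → TangentSpace I (1 : G)} (hξ : ContDiffOn ℝ ∞ ξ J) (hη : ContDiffOn ℝ ∞ η J) :
    ContDiffOn ℝ ∞ (fun t ↦ derivWithin η J t + algConnection I (ξ t) (η t)) J :=
  (hη.derivWithin hJ (by simp)).add
    ((algConnectionL I G).isBoundedBilinearMap.contDiff.comp_contDiffOn (hξ.prodMk hη))

lemma covDerivAlong_eq_ofBody_of_contDiffOn (hinv : IsLeftInvariantMetric I G) {q : ℝ → G}
    {J : Set ℝ} (hJ : UniqueDiffOn ℝ J) (hq : ContMDiffOn 𝓘(ℝ, ℝ) I ∞ q J)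
    {W : Π r : ℝ, TangentSpace I (q r)} {ξ w : ℝ → TangentSpace I (1 : G)}
    (hξ : ∀ r ∈ J, ξ r = bodyVelocity I q J r)
    (hw : ContDiffOn ℝ ∞ w J) (hW : ∀ r ∈ J, W r = ofBody I (q r) (w r)) :
    ∀ t ∈ J, covDerivAlong I q J W t
      = ofBody I (q t) (derivWithin w J t + algConnection I (ξ t) (w t)) := by
  intro t ht
  rw [covDerivAlong_eq_ofBody hinv ht (hJ t ht) ((hq t ht).mdifferentiableWithinAt (by simp))
    ((hw t ht).differentiableWithinAt (by simp)) hW, hξ t ht]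
  rfl

lemma eulerLagrange_iff_dynamics (hinv : IsLeftInvariantMetric I G) {q : ℝ → G} {J : Set ℝ}
    (hJ : UniqueDiffOn ℝ J) (hq : ContMDiffOn 𝓘(ℝ, ℝ) I ∞ q J)
    {ξ : Fin 3 → ℝ → TangentSpace I (1 : G)} (hξ : ∀ i, ContDiffOn ℝ ∞ (ξ i) J)
    (hξ0 : ∀ r ∈ J, ξ 0 r = bodyVelocity I q J r)
    (hrec : ∀ i : Fin 2, ∀ t ∈ J,
      derivWithin (ξ i.castSucc) J t = ξ i.succ t - algConnection I (ξ 0 t) (ξ i.castSucc t))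
    {t : ℝ} (ht : t ∈ J) (F : TangentSpace I (1 : G)) :
    covDerivAlong I q J (covDerivAlong I q J (covDerivAlong I q J (velocity I q J))) t
      + curvature I (q t) (covDerivAlong I q J (velocity I q J) t)
          (velocity I q J t) (velocity I q J t) = ofBody I (q t) F ↔
    derivWithin (ξ 2) J t + algConnection I (ξ 0 t) (ξ 2 t)
      + curvature I (1 : G) (ξ 1 t) (ξ 0 t) (ξ 0 t) = F := by
  have hv : ∀ r ∈ J, velocity I q J r = ofBody I (q r) (ξ 0 r) := fun r hr ↦ by
    rw [hξ0 r hr, ofBody_bodyVelocity]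
  have h1 : ∀ r ∈ J, covDerivAlong I q J (velocity I q J) r = ofBody I (q r) (ξ 1 r) :=
    fun r hr ↦ by
      rw [covDerivAlong_eq_ofBody_of_contDiffOn hinv hJ hq hξ0 (hξ 0) hv r hr]
      congr 1
      exact eq_sub_iff_add_eq.1 (hrec 0 r hr)
  have h2 : ∀ r ∈ J, covDerivAlong I q J (covDerivAlong I q J (velocity I q J)) r
      = ofBody I (q r) (ξ 2 r) := fun r hr ↦ by
    rw [covDerivAlong_eq_ofBody_of_contDiffOn hinv hJ hq hξ0 (hξ 1) h1 r hr]
    congr 1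
    exact eq_sub_iff_add_eq.1 (hrec 1 r hr)
  rw [covDerivAlong_eq_ofBody_of_contDiffOn hinv hJ hq hξ0 (hξ 2) h2 t ht, h1 t ht, hv t ht,
    curvature_ofBody hinv, ← map_add]
  exact (Function.LeftInverse.injective (toBody_ofBody I (q t))).eq_iff

end Reduction
end CollisionAvoidance
end

theorem proposition2
    {E : Type*} [NormedAddCommGroup E] [NormedSpace ℝ E] [FiniteDimensional ℝ E]
    {H : Type*} [TopologicalSpace H] (I : ModelWithCorners ℝ E H) [I.Boundaryless]
    {G : Type*} [TopologicalSpace G] [ChartedSpace H G] [Group G] [LieGroup I ∞ G]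
    [ConnectedSpace G]
    [RiemannianBundle (fun x : G ↦ TangentSpace I x)]
    [IsContMDiffRiemannianBundle I ∞ E (fun x : G ↦ TangentSpace I x)]
    (hinv : CollisionAvoidance.IsLeftInvariantMetric I G)
    {s : ℕ} (Edges : Set (Fin s × Fin s)) (hEdges : ∀ j k, (j, k) ∈ Edges → (k, j) ∈ Edges)
    (V : Fin s → Fin s → G → G → ℝ)
    (hV : ∀ j k, (j, k) ∈ Edges →
      ContMDiff (I.prod I) 𝓘(ℝ, ℝ) ∞ (fun p : G × G ↦ V j k p.1 p.2))
    (f : Fin s → Fin s → ℝ → ℝ)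
    (hVf : ∀ j k, (j, k) ∈ Edges → ∀ p q : G,
      V j k p q = f j k (CollisionAvoidance.riemannianDist I p q ^ 2))
    {a b : ℝ} (hab : a < b)
    (g : Fin s → ℝ → G)
    (hg : ∀ j, ContMDiffOn 𝓘(ℝ, ℝ) I ∞ (g j) (Set.Icc a b)) :
    CollisionAvoidance.SolvesEulerLagrange I Edges V a b g ↔
      ∃ ξ : Fin 3 → Fin s → ℝ → TangentSpace I (1 : G),
        (∀ i j, ContDiffOn ℝ ∞ (ξ i j) (Set.Icc a b)) ∧
        (∀ j, ∀ t ∈ Set.Icc a b,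
          ξ 0 j t = CollisionAvoidance.bodyVelocity I (g j) (Set.Icc a b) t) ∧
        CollisionAvoidance.SolvesReduced I Edges V a b (fun j k t ↦ (g j t)⁻¹ * g k t) ξ := by
  have hJ : UniqueDiffOn ℝ (Set.Icc a b) := uniqueDiffOn_Icc hab
  have hVinv (j k) (hjk : k ∈ CollisionAvoidance.neighbors Edges j) (x p q : G) :
      V j k (x * p) (x * q) = V j k p q := by
    have hjk : (j, k) ∈ Edges := by simpa [CollisionAvoidance.neighbors] using hjk
    rw [hVf j k hjk, hVf j k hjk, CollisionAvoidance.riemannianDist_mul_left hinv]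
  have hforce (j : Fin s) (t : ℝ) :
      - ∑ r ∈ CollisionAvoidance.neighbors Edges j,
          CollisionAvoidance.gradient₁ I (V j r) (g j t) (g r t)
        = CollisionAvoidance.ofBody I (g j t) (- ∑ r ∈ CollisionAvoidance.neighbors Edges j,
          CollisionAvoidance.gradient₁ I (V j r) 1 ((g j t)⁻¹ * g r t)) := by
    rw [map_neg, map_sum]
    congr 1
    refine Finset.sum_congr rfl fun r hr ↦ ?_
    refine CollisionAvoidance.gradient₁_eq_ofBody hinv (hV j r ?_) (hVinv j r hr) _ _
    simpa [CollisionAvoidance.neighbors] using hr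
  constructor
  · intro h
    let B := CollisionAvoidance.algConnection (G := G) I
    let ξ₀ (j : Fin s) : ℝ → TangentSpace I (1 : G) :=
      CollisionAvoidance.bodyVelocity I (g j) (Set.Icc a b)
    let ξ₁ (j : Fin s) : ℝ → TangentSpace I (1 : G) :=
      fun t ↦ derivWithin (ξ₀ j) (Set.Icc a b) t + B (ξ₀ j t) (ξ₀ j t)
    let ξ₂ (j : Fin s) : ℝ → TangentSpace I (1 : G) :=
      fun t ↦ derivWithin (ξ₁ j) (Set.Icc a b) t + B (ξ₀ j t) (ξ₁ j t)
    let ξ : Fin 3 → Fin s → ℝ → TangentSpace I (1 : G) := ![ξ₀, ξ₁, ξ₂]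
    have hξ₀ (j) : ContDiffOn ℝ ∞ (ξ₀ j) (Set.Icc a b) :=
      CollisionAvoidance.contDiffOn_bodyVelocity hinv hJ (hg j)
    have hξ₁ (j) : ContDiffOn ℝ ∞ (ξ₁ j) (Set.Icc a b) :=
      CollisionAvoidance.contDiffOn_derivWithin_add_algConnection hJ (hξ₀ j) (hξ₀ j)
    have hξ₂ (j) : ContDiffOn ℝ ∞ (ξ₂ j) (Set.Icc a b) :=
      CollisionAvoidance.contDiffOn_derivWithin_add_algConnection hJ (hξ₀ j) (hξ₁ j)
    have hξ (i j) : ContDiffOn ℝ ∞ (ξ i j) (Set.Icc a b) := by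
      fin_cases i
      exacts [hξ₀ j, hξ₁ j, hξ₂ j]
    have hrec (i : Fin 2) (j) (t) (_ : t ∈ Set.Icc a b) :
        derivWithin (ξ i.castSucc j) (Set.Icc a b) t
          = ξ i.succ j t - CollisionAvoidance.algConnection I (ξ 0 j t) (ξ i.castSucc j t) := by
      fin_cases i
      exacts [(add_sub_cancel_right _ _).symm, (add_sub_cancel_right _ _).symm]
    refine ⟨ξ, hξ, fun j t _ ↦ rfl, ?_, hrec, fun j t ht ↦ ?_⟩
    · intro j k _ t ht
      exact CollisionAvoidance.velocity_inv_mul (hJ t ht)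
        ((hg j t ht).mdifferentiableWithinAt (by simp))
        ((hg k t ht).mdifferentiableWithinAt (by simp))
    · refine (CollisionAvoidance.eulerLagrange_iff_dynamics (ξ := fun i ↦ ξ i j) hinv hJ (hg j)
        (fun i ↦ hξ i j) (fun _ _ ↦ rfl) (fun i ↦ hrec i j) ht _).1 ?_
      rw [← hforce]
      exact h j t ht
  · rintro ⟨ξ, hξ, hξ0, hred⟩ j t ht
    rw [hforce]
    exact (CollisionAvoidance.eulerLagrange_iff_dynamics (ξ := fun i ↦ ξ i j) hinv hJ (hg j)
      (fun i ↦ hξ i j) (hξ0 j) (fun i ↦ hred.recursion i j) ht _).2 (hred.dynamics j t ht)
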